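/- For $i\in\mathbb{Z}$ let $\Lambda_i=\{\mathbf v\in\mathbb{Z}^3:\ \mathbf v\cdot(1,1,1)=i\}$, and let the Necker cube surface $\mathbf{N}\subset\mathbb{R}^3$ be the union of all closed unit squares in $\mathbb{R}^3$ whose four vertices lie in $\Lambda_{-1}\cup\Lambda_0\cup\Lambda_1$. Its singularities are the vertices of these squares. Around every other point of $\mathbf{N}$ there are flat local coordinates, obtained by unfolding two squares that share an edge into the plane. A geodesic $\gamma:\mathbb{R}\to\mathbf{N}$ is a map that avoids the singularities and that is, near every $t\in\mathbb{R}$, a nonconstant affine map in such coordinates (for instance, a unit speed geodesic); it is periodic if $\gamma(t+p)=\gamma(t)$ for some $p>0$ and all $t\in\mathbb{R}$. **Theorem (Sixfold symmetry).** If $\gamma:\mathbb{R}\to\mathbf{N}$ is a periodic geodesic with least (positive) period $\ell$, then there is an isometry $\xi:\mathbb{R}^3\to\mathbb{R}^3$ of order six with $\xi(\mathbf{N})=\mathbf{N}$ such that $$\xi\circ\gamma(t)=\gamma\left(t+\tfrac{\ell}{6}\right)\quad\text{for all } t\in\mathbb{R}.$$ -/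

import Mathlib

noncomputable section

namespace NeckerCube

/-- Euclidean three-space. -/
abbrev E3 : Type := EuclideanSpace ℝ (Fin 3)

/-- `Lam i` is the set of integer points of `ℝ³` whose dot product with `(1, 1, 1)` is `i`. -/
def Lam (i : ℤ) : Set E3 :=
  {v | ∃ n : Fin 3 → ℤ, (∀ k, v k = (n k : ℝ)) ∧ ∑ k, n k = i}

/-- The vertices: the integer points whose dot product with `(1, 1, 1)` is `-1`, `0` or `1`. -/
def vertices : Set E3 := Lam (-1) ∪ Lam 0 ∪ Lam 1

/-- The closed parallelogram with corner `a` and side vectors `u`, `w`. -/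
def parallelogram (a u w : E3) : Set E3 :=
  {x | ∃ s ∈ Set.Icc (0 : ℝ) 1, ∃ t ∈ Set.Icc (0 : ℝ) 1, x = a + s • u + t • w}

/-- The corner `a` and the side vectors `u`, `w` span a constituent square: a unit square of `ℝ³`
all four of whose corners are in `vertices`. -/
structure IsConstituentSquare (a u w : E3) : Prop where
  norm_left : ‖u‖ = 1
  norm_right : ‖w‖ = 1
  orthogonal : inner ℝ u w = 0
  corner_mem : a ∈ vertices
  corner_left_mem : a + u ∈ vertices
  corner_right_mem : a + w ∈ vertices
  corner_opposite_mem : a + u + w ∈ vertices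

/-- The Necker cube surface `N`, the union of all constituent squares. -/
def surface : Set E3 :=
  {x | ∃ a u w : E3, IsConstituentSquare a u w ∧ x ∈ parallelogram a u w}

/-- Two different constituent squares that share the edge from `a` to `a + w`; their other sides
at `a` are `u` and `u'`. -/
structure IsHinge (a u u' w : E3) : Prop where
  square : IsConstituentSquare a u w
  square' : IsConstituentSquare a u' w
  ne : u ≠ u'

/-- The inverse of the flat chart of `N` at a hinge: the rectangle `[-1, 1] × [0, 1]` is folded
along its middle line `{0} × [0, 1]` onto the two squares of the hinge. It sends
`[0, 1] × [0, 1]` isometrically onto the square with sides `u, w` and `[-1, 0] × [0, 1]`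
isometrically onto the square with sides `u', w`. -/
def fold (a u u' w : E3) (q : ℝ × ℝ) : E3 :=
  a + max q.1 0 • u + max (-q.1) 0 • u' + q.2 • w

/-- The open domain of `fold`. Its image is the union of the two open squares and of the open
edge between them, so these images cover exactly the points of `N` that are not vertices. The
vertices, where three or six squares come together, are the singularities of `N`. -/
def chartDomain : Set (ℝ × ℝ) := Set.Ioo (-1) 1 ×ˢ Set.Ioo 0 1

/-- A (bi-infinite) geodesic `γ : ℝ → N`: it avoids the singularities, and near every time it is
a nonconstant affine map `s ↦ p + (s - t) v` in the local flat coordinates of `N`. -/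
def IsGeodesic (γ : ℝ → surface) : Prop :=
  ∀ t : ℝ, ∃ a u u' w : E3, IsHinge a u u' w ∧
    ∃ p v : ℝ × ℝ, v ≠ 0 ∧ ∃ ε > 0, ∀ s ∈ Set.Ioo (t - ε) (t + ε),
      p + (s - t) • v ∈ chartDomain ∧ (γ s : E3) = fold a u u' w (p + (s - t) • v)

/-- `ℓ` is the least (positive) period of `γ`. -/
def IsLeastPeriod (γ : ℝ → surface) (ℓ : ℝ) : Prop :=
  IsLeast {p : ℝ | 0 < p ∧ Function.Periodic γ p} ℓ

end NeckerCube

end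

/-!
# Periodic geodesics on the Necker cube surface have sixfold symmetry

Rolling the plane with its unit square grid onto the surface along a geodesic turns the geodesic
into a straight line `t ↦ (x + t v₁, y + t v₂)` that misses the grid points. After a choice of
corner in the first square, `v₁, v₂ ≥ 0`, and the line leaves each grid cell through its right or
its upper edge. A placed square with a marked corner is encoded as a `Frame`: the corner, the
coordinate axes and signs of its two sides, and an orientation. The frames met along the line are
obtained from the first one by the moves `Frame.right` and `Frame.up`, in the order of a cutting
sequence (`Frame.develop`, `column`). That the geodesic really follows this recipe is
`IsGeodesic.eq_develop`: charts at edge points force the move, and grid points cannot be met.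

If the geodesic has period `ℓ`, then the frame at time `ℓ` is the first frame again
(`Frame.eq_of_germ`), so `ℓ (v₁, v₂) = m (p, q)` with coprime natural numbers `p, q`, and the
cutting sequence is the word of slope `q / p`: with `N = p + q`, the move number `k` is `up` exactly
if `(b + k p) % N < q`. As `k` runs through a period, the residue `(b + k p) % N` runs once through
`0, …, N - 1`, which makes the following alternating sums computable.

* If `p` and `q` are odd, then `N` moves reverse both signs and change the axis of the first side by
  an alternating sum that equals `±1` modulo `3`. Hence they act as the rotoreflection
  `x ↦ -(cyclic shift of x) + n`, which has order six and preserves the surface. Comparing axes and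
  signs shows that `6 ∣ m`; as six times `ℓ / m` is a period, `m = 6`
  (`Frame.OnSurface.exists_rotoreflection`, `IsGeodesic.exists_symmetry`).
* If `p + q` is odd, then `2 N` moves act as a translation. Modulo `3`, a linear functional of the
  centre of the square (`Frame.moment`) changes by `±1` in each move, and by `±2` in total. So
  the translation is not trivial and the geodesic drifts off, which excludes periodicity
  (`Frame.develop_ne_self_of_odd`).
-/

noncomputable section

namespace NeckerCube

open Filter Topology
open Fin.CommRing

/-! ### Frames -/

/-- A combinatorial unit square of `ℝ³` with a marked corner and an order of the two sides there.
The first side is `sign₁` times the basis vector of index `axis`. The second side is `sign₂` times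
the basis vector of index `axis + turn`, where `turn = ±1` is the product of the two signs and of
`orientation`; this encoding makes `orientation` invariant when the square rolls over an edge. Axes
are elements of `Fin 3`, taken modulo `3`. -/
@[ext]
structure Frame where
  corner : Fin 3 → ℤ
  axis : Fin 3
  sign₁ : ℤˣ
  sign₂ : ℤˣ
  orientation : ℤˣ

namespace Frame

/-- The difference `±1` of the axes of the second and the first side. -/
def turn (F : Frame) : Fin 3 := (((F.orientation * F.sign₁ * F.sign₂ : ℤˣ) : ℤ) : Fin 3)

/-- The axis of the second side. -/
abbrev axis₂ (F : Frame) : Fin 3 := F.axis + F.turn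

/-- The axis orthogonal to the square. -/
abbrev axis₃ (F : Frame) : Fin 3 := F.axis - F.turn

/-- All four corners of the square have coordinate sum `-1`, `0` or `1`, which means that the centre
of the square has coordinate sum `0`. -/
def OnSurface (F : Frame) : Prop := 2 * ∑ m, F.corner m + F.sign₁ + F.sign₂ = 0

/-- The point with coordinates `x, y` in the frame. -/
def pos (F : Frame) (x y : ℝ) : E3 :=
  WithLp.toLp 2 fun m => (F.corner m : ℝ) + (if m = F.axis then ((F.sign₁ : ℤ) : ℝ) * x else 0) +
    (if m = F.axis₂ then ((F.sign₂ : ℤ) : ℝ) * y else 0)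

/-- The flat chart around the left edge `x = 0` of the square: points with `x < 0` are placed on the
other square at this edge. -/
def unfold (F : Frame) (x y : ℝ) : E3 :=
  WithLp.toLp 2 fun m => (F.corner m : ℝ) +
    (if m = F.axis then ((F.sign₁ : ℤ) : ℝ) * max x 0 else 0) +
    (if m = F.axis₂ then ((F.sign₂ : ℤ) : ℝ) * y else 0) +
    (if m = F.axis₃ then ((F.sign₁ : ℤ) : ℝ) * max (-x) 0 else 0)

/-- The square across the right edge, marked at its lower left corner. -/
def right (F : Frame) : Frame where
  corner := F.corner + Pi.single F.axis (F.sign₁ : ℤ)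
  axis := F.axis₃
  sign₁ := -F.sign₁
  sign₂ := F.sign₂
  orientation := F.orientation

/-- The square across the upper edge, marked at its lower left corner. -/
def up (F : Frame) : Frame where
  corner := F.corner + Pi.single F.axis₂ (F.sign₂ : ℤ)
  axis := F.axis
  sign₁ := F.sign₁
  sign₂ := -F.sign₂
  orientation := F.orientation

/-- The same square with its two sides exchanged. -/
def transpose (F : Frame) : Frame where
  corner := F.corner
  axis := F.axis₂
  sign₁ := F.sign₂
  sign₂ := F.sign₁
  orientation := -F.orientation

/-- The other square at the left edge, with the same corner and second side. -/
def mirror (F : Frame) : Frame where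
  corner := F.corner
  axis := F.axis₃
  sign₁ := F.sign₁
  sign₂ := F.sign₂
  orientation := -F.orientation

/-- The same square, marked at its upper left corner. -/
def flip (F : Frame) : Frame where
  corner := F.corner + Pi.single F.axis₂ (F.sign₂ : ℤ)
  axis := F.axis
  sign₁ := F.sign₁
  sign₂ := -F.sign₂
  orientation := -F.orientation

variable (F : Frame)

theorem turn_ne_zero : F.turn ≠ 0 := by
  unfold turn
  rcases Int.units_eq_one_or (F.orientation * F.sign₁ * F.sign₂) with h | h <;> rw [h] <;> decide

@[simp] theorem turn_right : F.right.turn = -F.turn := by simp [turn, right]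
@[simp] theorem turn_up : F.up.turn = -F.turn := by simp [turn, up]
@[simp] theorem turn_mirror : F.mirror.turn = -F.turn := by simp [turn, mirror]
@[simp] theorem turn_flip : F.flip.turn = F.turn := by simp [turn, flip]
@[simp] theorem turn_transpose : F.transpose.turn = -F.turn := by
  simp [turn, transpose]; ring

theorem three_axes {c e : Fin 3} (he : e ≠ 0) :
    c ≠ c + e ∧ c ≠ c - e ∧ c + e ≠ c - e ∧ c + e + e = c - e ∧ c - e - e = c + e ∧
      ∀ m, m = c ∨ m = c + e ∨ m = c - e := by
  revert c e; decide

theorem axis_ne_axis₂ : F.axis ≠ F.axis₂ := (three_axes F.turn_ne_zero).1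

theorem axis_ne_axis₃ : F.axis ≠ F.axis₃ := (three_axes F.turn_ne_zero).2.1

theorem axis₂_ne_axis₃ : F.axis₂ ≠ F.axis₃ := (three_axes F.turn_ne_zero).2.2.1

theorem eq_axis (m : Fin 3) : m = F.axis ∨ m = F.axis₂ ∨ m = F.axis₃ :=
  (three_axes F.turn_ne_zero).2.2.2.2.2 m

theorem ext_axes {z z' : E3} (h₁ : z F.axis = z' F.axis) (h₂ : z F.axis₂ = z' F.axis₂)
    (h₃ : z F.axis₃ = z' F.axis₃) : z = z' := by
  ext m
  rcases F.eq_axis m with h | h | h <;> rw [h] <;> assumption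

theorem sum_axes {M : Type*} [AddCommMonoid M] (f : Fin 3 → M) :
    ∑ m, f m = f F.axis + f F.axis₂ + f F.axis₃ := by
  have h1 := F.axis_ne_axis₂
  have h2 := F.axis_ne_axis₃
  have h3 := F.axis₂_ne_axis₃
  have : (Finset.univ : Finset (Fin 3)) = {F.axis, F.axis₂, F.axis₃} := by
    ext m; simpa using F.eq_axis m
  rw [this, Finset.sum_insert (by simp [h1, h2]), Finset.sum_insert (by simp [h3]),
    Finset.sum_singleton, add_assoc]

theorem pos_axis (x y : ℝ) : F.pos x y F.axis = F.corner F.axis + (F.sign₁ : ℤ) * x := by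
  simp [pos, F.axis_ne_axis₂, -left_eq_add]

theorem pos_axis₂ (x y : ℝ) : F.pos x y F.axis₂ = F.corner F.axis₂ + (F.sign₂ : ℤ) * y := by
  simp [pos, F.axis_ne_axis₂.symm, -add_eq_left]

theorem pos_axis₃ (x y : ℝ) : F.pos x y F.axis₃ = F.corner F.axis₃ := by
  simp only [pos, if_neg F.axis_ne_axis₃.symm, if_neg F.axis₂_ne_axis₃.symm, add_zero]

theorem unfold_axis (x y : ℝ) :
    F.unfold x y F.axis = F.corner F.axis + (F.sign₁ : ℤ) * max x 0 := by
  simp only [unfold, if_neg F.axis_ne_axis₂, if_neg F.axis_ne_axis₃, if_true, add_zero]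

theorem unfold_axis₂ (x y : ℝ) :
    F.unfold x y F.axis₂ = F.corner F.axis₂ + (F.sign₂ : ℤ) * y := by
  simp only [unfold, if_neg F.axis_ne_axis₂.symm, if_neg F.axis₂_ne_axis₃, if_true, add_zero]

theorem unfold_axis₃ (x y : ℝ) :
    F.unfold x y F.axis₃ = F.corner F.axis₃ + (F.sign₁ : ℤ) * max (-x) 0 := by
  simp only [unfold, if_neg F.axis_ne_axis₃.symm, if_neg F.axis₂_ne_axis₃.symm, if_true, add_zero]

theorem axis₂_right : F.right.axis₂ = F.axis₂ := by
  unfold axis₂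
  rw [turn_right, ← sub_eq_add_neg]
  exact (three_axes F.turn_ne_zero (c := F.axis)).2.2.2.2.1

theorem axis₃_right : F.right.axis₃ = F.axis := by
  unfold axis₃
  rw [turn_right, sub_neg_eq_add]
  exact sub_add_cancel _ _

theorem axis₂_mirror : F.mirror.axis₂ = F.axis₂ := by
  unfold axis₂
  rw [turn_mirror, ← sub_eq_add_neg]
  exact (three_axes F.turn_ne_zero (c := F.axis)).2.2.2.2.1

theorem axis₃_mirror : F.mirror.axis₃ = F.axis := by
  unfold axis₃
  rw [turn_mirror, sub_neg_eq_add]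
  exact sub_add_cancel _ _

theorem axis₂_up : F.up.axis₂ = F.axis₃ := by
  unfold axis₂
  rw [turn_up, ← sub_eq_add_neg]; rfl

theorem axis₂_transpose : F.transpose.axis₂ = F.axis := by
  unfold axis₂
  rw [turn_transpose, ← sub_eq_add_neg]
  exact add_sub_cancel_right _ _

theorem axis₃_transpose : F.transpose.axis₃ = F.axis₃ := by
  unfold axis₃
  rw [turn_transpose, sub_neg_eq_add]
  exact (three_axes F.turn_ne_zero (c := F.axis)).2.2.2.1

theorem transpose_right : F.transpose.right = F.up.transpose := by
  exact Frame.ext rfl (F.axis₃_transpose.trans F.axis₂_up.symm) rfl rfl rfl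

theorem pos_transpose (x y : ℝ) : F.transpose.pos x y = F.pos y x := by
  apply F.ext_axes
  · have := F.transpose.pos_axis₂ x y
    rw [axis₂_transpose] at this
    rw [this, pos_axis]; rfl
  · have := F.transpose.pos_axis x y
    rw [pos_axis₂]; exact this
  · have := F.transpose.pos_axis₃ x y
    rw [axis₃_transpose] at this
    rw [this, pos_axis₃]; rfl

theorem unfold_mirror (x y : ℝ) : F.mirror.unfold x y = F.unfold (-x) y := by
  apply F.ext_axes
  · have := F.mirror.unfold_axis₃ x y
    rw [axis₃_mirror] at this
    rw [this, unfold_axis]; rfl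
  · have := F.mirror.unfold_axis₂ x y
    rw [axis₂_mirror] at this
    rw [this, unfold_axis₂]; rfl
  · have := F.mirror.unfold_axis x y
    rw [unfold_axis₃, neg_neg]; exact this

theorem axis₂_flip : F.flip.axis₂ = F.axis₂ := by
  simp only [axis₂, turn_flip]; rfl

theorem axis₃_flip : F.flip.axis₃ = F.axis₃ := by
  simp only [axis₃, turn_flip]; rfl

theorem unfold_flip (x y : ℝ) : F.flip.unfold x y = F.unfold x (1 - y) := by
  have h1 := F.axis_ne_axis₂
  have h3 := F.axis₂_ne_axis₃
  apply F.ext_axes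
  · have := F.flip.unfold_axis x y
    rw [unfold_axis]
    refine this.trans ?_
    simp only [flip, Pi.add_apply, Pi.single_eq_of_ne h1, add_zero]
  · have := F.flip.unfold_axis₂ x y
    rw [axis₂_flip] at this
    rw [this, unfold_axis₂]
    simp only [flip, Pi.add_apply, Pi.single_eq_same]
    push_cast; ring
  · have := F.flip.unfold_axis₃ x y
    rw [axis₃_flip] at this
    rw [this, unfold_axis₃]
    simp only [flip, Pi.add_apply, Pi.single_eq_of_ne h3.symm, add_zero]

theorem sum_single (c : Fin 3) (s : ℤ) : ∑ m, (Pi.single c s : Fin 3 → ℤ) m = s := by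
  simp

variable {F}

theorem OnSurface.right (h : F.OnSurface) : F.right.OnSurface := by
  unfold OnSurface at *
  simp only [Frame.right, Pi.add_apply, Finset.sum_add_distrib, sum_single, Units.val_neg]
  linarith

theorem OnSurface.up (h : F.OnSurface) : F.up.OnSurface := by
  unfold OnSurface at *
  simp only [Frame.up, Pi.add_apply, Finset.sum_add_distrib, sum_single, Units.val_neg]
  linarith

theorem OnSurface.flip (h : F.OnSurface) : F.flip.OnSurface := by
  unfold OnSurface at *
  simp only [Frame.flip, Pi.add_apply, Finset.sum_add_distrib, sum_single, Units.val_neg]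
  linarith

theorem OnSurface.mirror (h : F.OnSurface) : F.mirror.OnSurface := h

theorem OnSurface.transpose (h : F.OnSurface) : F.transpose.OnSurface := by
  unfold OnSurface at *
  simp only [Frame.transpose]
  linarith

end Frame

/-! ### Constituent squares and hinges as frames -/

theorem exists_eq_single {n : Fin 3 → ℤ} (h : ∑ k, n k ^ 2 = 1) :
    ∃ (c : Fin 3) (s : ℤˣ), n = Pi.single c (s : ℤ) := by
  rw [Fin.sum_univ_three] at h
  have key : ∀ a b c : ℤ, a ^ 2 + b ^ 2 + c ^ 2 = 1 → a = -1 ∨ a = 0 ∨ a = 1 := by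
    intro a b c h
    have h1 : a ≤ 1 := by nlinarith [sq_nonneg b, sq_nonneg c]
    have h2 : -1 ≤ a := by nlinarith [sq_nonneg b, sq_nonneg c]
    omega
  have h0 := key _ _ _ h
  have h1 := key (n 1) (n 0) (n 2) (by linarith)
  have h2 := key (n 2) (n 0) (n 1) (by linarith)
  have hn : n = ![n 0, n 1, n 2] := by ext k; fin_cases k <;> rfl
  rw [hn]
  rcases h0 with h0 | h0 | h0 <;> rcases h1 with h1 | h1 | h1 <;> rcases h2 with h2 | h2 | h2 <;>
    rw [h0, h1, h2] at h ⊢ <;> first | (exfalso; revert h; norm_num; done) | skip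
  all_goals first
    | exact ⟨0, 1, by decide⟩ | exact ⟨1, 1, by decide⟩ | exact ⟨2, 1, by decide⟩
    | exact ⟨0, -1, by decide⟩ | exact ⟨1, -1, by decide⟩ | exact ⟨2, -1, by decide⟩

theorem mem_vertices_iff {z : E3} : z ∈ vertices ↔
    ∃ n : Fin 3 → ℤ, (∀ k, z k = n k) ∧ -1 ≤ ∑ k, n k ∧ ∑ k, n k ≤ 1 := by
  constructor
  · rintro ((⟨n, h, h'⟩ | ⟨n, h, h'⟩) | ⟨n, h, h'⟩) <;> exact ⟨n, h, by omega⟩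
  · rintro ⟨n, h, h1, h2⟩
    obtain h' | h' | h' : ∑ k, n k = -1 ∨ ∑ k, n k = 0 ∨ ∑ k, n k = 1 := by omega
    · exact Or.inl (Or.inl ⟨n, h, h'⟩)
    · exact Or.inl (Or.inr ⟨n, h, h'⟩)
    · exact Or.inr ⟨n, h, h'⟩

theorem exists_eq_single_of_norm {u : E3} (n : Fin 3 → ℤ) (hn : ∀ k, u k = n k) (h : ‖u‖ = 1) :
    ∃ (c : Fin 3) (s : ℤˣ), ∀ k, u k = if k = c then ((s : ℤ) : ℝ) else 0 := by
  have h2 : ∑ k, (n k : ℝ) ^ 2 = 1 := by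
    have := EuclideanSpace.real_norm_sq_eq u
    simp only [h, hn] at this
    linarith
  obtain ⟨c, s, hs⟩ := exists_eq_single (n := n) (by exact_mod_cast h2)
  refine ⟨c, s, fun k => ?_⟩
  rw [hn, hs, Pi.single_apply]
  split_ifs <;> simp

/-- A side joins integer points and has length `1`, so it is a signed basis vector; the coordinate
sums of the four corners then leave one choice for that of the first corner. -/
theorem IsConstituentSquare.exists_frame {a u w : E3} (h : IsConstituentSquare a u w) :
    ∃ F : Frame, F.OnSurface ∧ (∀ m, a m = F.corner m) ∧
      (∀ m, u m = if m = F.axis then ((F.sign₁ : ℤ) : ℝ) else 0) ∧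
      (∀ m, w m = if m = F.axis₂ then ((F.sign₂ : ℤ) : ℝ) else 0) := by
  obtain ⟨n, hn, hn1, hn2⟩ := mem_vertices_iff.1 h.corner_mem
  obtain ⟨nu, hu, hu1, hu2⟩ := mem_vertices_iff.1 h.corner_left_mem
  obtain ⟨nw, hw, hw1, hw2⟩ := mem_vertices_iff.1 h.corner_right_mem
  obtain ⟨no, ho, ho1, ho2⟩ := mem_vertices_iff.1 h.corner_opposite_mem
  obtain ⟨c, s, hs⟩ := exists_eq_single_of_norm (u := u) (fun k => nu k - n k)
    (fun k => by have := hu k; simp only [PiLp.add_apply, hn] at this; push_cast; linarith)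
    h.norm_left
  obtain ⟨d, t, ht⟩ := exists_eq_single_of_norm (u := w) (fun k => nw k - n k)
    (fun k => by have := hw k; simp only [PiLp.add_apply, hn] at this; push_cast; linarith)
    h.norm_right
  have hcd : d ≠ c := by
    rintro rfl
    have := h.orthogonal
    rw [PiLp.inner_apply] at this
    simp only [hs, ht] at this
    rcases Int.units_eq_one_or s with h1 | h1 <;> rcases Int.units_eq_one_or t with h2 | h2 <;>
      simp [h1, h2] at this
  have e1 : nu = n + Pi.single c (s : ℤ) := by
    ext k
    have := hu k
    simp only [PiLp.add_apply, hn, hs] at this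
    have h' : (nu k : ℝ) = ((n k + (if k = c then (s : ℤ) else 0) : ℤ) : ℝ) := by
      push_cast; rw [← this]
    rw [Pi.add_apply, Pi.single_apply]; exact_mod_cast h'
  have e2 : nw = n + Pi.single d (t : ℤ) := by
    ext k
    have := hw k
    simp only [PiLp.add_apply, hn, ht] at this
    have h' : (nw k : ℝ) = ((n k + (if k = d then (t : ℤ) else 0) : ℤ) : ℝ) := by
      push_cast; rw [← this]
    rw [Pi.add_apply, Pi.single_apply]; exact_mod_cast h'
  have e3 : no = n + Pi.single c (s : ℤ) + Pi.single d (t : ℤ) := by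
    ext k
    have := ho k
    simp only [PiLp.add_apply, hn, ht, hs] at this
    have h' : (no k : ℝ) = ((n k + (if k = c then (s : ℤ) else 0)
        + (if k = d then (t : ℤ) else 0) : ℤ) : ℝ) := by
      push_cast; rw [← this]
    rw [Pi.add_apply, Pi.single_apply, Pi.add_apply, Pi.single_apply]; exact_mod_cast h'
  simp only [e1, e2, e3, Pi.add_apply, Finset.sum_add_distrib, Frame.sum_single] at hu1 hu2 hw1 hw2 ho1 ho2
  obtain ⟨o, hoo⟩ : ∃ o : ℤˣ, d = c + (((o * s * t : ℤˣ) : ℤ) : Fin 3) := by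
    have h3 : ∀ c d : Fin 3, d ≠ c → d = c + ((1 : ℤ) : Fin 3) ∨ d = c + ((-1 : ℤ) : Fin 3) := by
      decide
    have hss : s * s = 1 := Int.units_mul_self s
    have htt : t * t = 1 := Int.units_mul_self t
    rcases h3 c d hcd with h3 | h3
    · refine ⟨s * t, ?_⟩
      have : s * t * s * t = 1 := by rw [mul_assoc, mul_mul_mul_comm, hss, htt, one_mul]
      rw [this]; simpa using h3
    · refine ⟨-(s * t), ?_⟩
      have : -(s * t) * s * t = -1 := by
        rw [neg_mul, neg_mul, mul_assoc, mul_mul_mul_comm, hss, htt, one_mul]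
      rw [this]; simpa using h3
  refine ⟨⟨n, c, s, t, o⟩, ?_, hn, hs, ?_⟩
  · unfold Frame.OnSurface
    simp only
    rcases Int.units_eq_one_or s with h1 | h1 <;> rcases Int.units_eq_one_or t with h2 | h2 <;>
      simp only [h1, h2, Units.val_neg, Units.val_one] at * <;> omega
  · simp only [ht, Frame.axis₂, Frame.turn, ← hoo]; intro m; trivial

/-- The common side and the coordinate sum at the corner determine the sign of the third side, so
the two squares of a hinge are a frame and its `Frame.mirror`. -/
theorem IsHinge.exists_frame {a u u' w : E3} (h : IsHinge a u u' w) :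
    ∃ F : Frame, F.OnSurface ∧ ∀ x : ℝ × ℝ, fold a u u' w x = F.unfold x.1 x.2 := by
  obtain ⟨F, hF, ha, hu, hw⟩ := h.square.exists_frame
  obtain ⟨G, hG, ha', hu', hw'⟩ := h.square'.exists_frame
  have hc : F.corner = G.corner := by
    ext m; exact Int.cast_injective (α := ℝ) ((ha m).symm.trans (ha' m))
  have h2 : F.axis₂ = G.axis₂ ∧ F.sign₂ = G.sign₂ := by
    have h3 := (hw F.axis₂).symm.trans (hw' F.axis₂)
    rw [if_pos rfl] at h3
    split_ifs at h3 with h4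
    · exact ⟨h4, Units.ext (Int.cast_injective (α := ℝ) h3)⟩
    · exact absurd h3 (by simp)
  have hs : F.sign₁ = G.sign₁ := by
    unfold Frame.OnSurface at hF hG
    rw [hc, h2.2] at hF
    exact Units.ext (by linarith)
  have hax : G.axis = F.axis₃ := by
    rcases F.eq_axis G.axis with h3 | h3 | h3
    · refine absurd ?_ h.ne
      ext m
      rw [hu, hu', h3, hs]
    · rw [h2.1] at h3
      exact absurd h3 G.axis_ne_axis₂
    · exact h3
  refine ⟨F, hF, fun x => ?_⟩
  ext m
  simp only [fold, PiLp.add_apply, PiLp.smul_apply, ha, hu, hu', hw, smul_eq_mul, Frame.unfold, hax,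
    ← hs]
  split_ifs <;> ring

/-! ### Germs of affine maps -/

/-- Continuous induction on `[0, ∞)`. -/
theorem real_induction {p : ℝ → Prop} (h0 : ∀ᶠ s in 𝓝[≥] 0, p s)
    (step : ∀ T > 0, (∀ s ∈ Set.Ico 0 T, p s) → ∀ᶠ s in 𝓝[≥] T, p s) : ∀ t ≥ 0, p t := by
  by_contra! hbad
  obtain ⟨t, ht, hpt⟩ := hbad
  set B := {t : ℝ | 0 ≤ t ∧ ¬ p t} with hB
  have hne : B.Nonempty := ⟨t, ht, hpt⟩
  have hbd : BddBelow B := ⟨0, fun s hs => hs.1⟩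
  have h0B : 0 ≤ sInf B := le_csInf hne fun s hs => hs.1
  have hgood : ∀ s ∈ Set.Ico 0 (sInf B), p s := fun s hs => by
    by_contra h
    exact absurd (csInf_le hbd ⟨hs.1, h⟩) (not_le.2 hs.2)
  have hev : ∀ᶠ s in 𝓝[≥] (sInf B), p s := by
    rcases h0B.eq_or_lt with h | h
    · rwa [← h]
    · exact step _ h hgood
  obtain ⟨u, hu, hu'⟩ := (mem_nhdsGE_iff_exists_Ico_subset).1 hev
  obtain ⟨s, hs, hsu⟩ := (csInf_lt_iff hbd hne).1 hu
  exact hs.2 (hu' ⟨csInf_le hbd hs, hsu⟩)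

theorem affine_germ_unique {a b a' b' t : ℝ}
    (h : ∀ᶠ s in 𝓝[<] t, a + (s - t) * b = a' + (s - t) * b') : a = a' ∧ b = b' := by
  obtain ⟨l, hl, hl'⟩ := (mem_nhdsLT_iff_exists_Ioo_subset).1 h
  have hl : l < t := hl
  have h1 : a + (t - (t - l) / 2 - t) * b = a' + (t - (t - l) / 2 - t) * b' :=
    hl' (a := t - (t - l) / 2) ⟨by linarith, by linarith⟩
  have h2 : a + (t - (t - l) / 3 - t) * b = a' + (t - (t - l) / 3 - t) * b' :=
    hl' (a := t - (t - l) / 3) ⟨by linarith, by linarith⟩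
  have h3 : (t - l) * (b - b') = 0 := by linarith
  have h4 : b - b' = 0 := (mul_eq_zero.1 h3).resolve_left (by linarith)
  have h5 : b = b' := by linarith
  subst h5
  exact ⟨by linarith, rfl⟩

/-- An inner point of an edge has a nonintegral coordinate along this edge. -/
theorem add_unit_mul_ne_int (n k : ℤ) (s : ℤˣ) {y : ℝ} (hy : 0 < y) (hy' : y < 1) :
    (n : ℝ) + (s : ℤ) * y ≠ k := by
  intro h
  rcases Int.units_eq_one_or s with rfl | rfl
  · have h1 : (n : ℝ) < k := by simp at h; linarith
    have h2 : (k : ℝ) < n + 1 := by simp at h; linarith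
    norm_cast at h1 h2; omega
  · have h1 : (k : ℝ) < n := by simp at h; linarith
    have h2 : (n : ℝ) < k + 1 := by simp at h; linarith
    norm_cast at h1 h2; omega

theorem eq_of_add_unit_mul_eq {n k : ℤ} {s : ℤˣ} {y z : ℝ} (hy : 0 < y) (hy' : y < 1) (hz : 0 ≤ z)
    (hz' : z < 1) (h : (n : ℝ) + (s : ℤ) * y = k + (s : ℤ) * z) : n = k ∧ y = z := by
  have : n = k := by
    rcases Int.units_eq_one_or s with rfl | rfl
    · simp at h
      have h1 : (n : ℝ) < k + 1 := by linarith
      have h2 : (k : ℝ) < n + 1 := by linarith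
      norm_cast at h1 h2; omega
    · simp at h
      have h1 : (n : ℝ) < k + 1 := by linarith
      have h2 : (k : ℝ) < n + 1 := by linarith
      norm_cast at h1 h2; omega
  subst this
  refine ⟨rfl, ?_⟩
  rcases Int.units_eq_one_or s with rfl | rfl <;> simpa using h

namespace Frame

variable (F : Frame)

theorem unfold_of_nonneg {x : ℝ} (hx : 0 ≤ x) (y : ℝ) : F.unfold x y = F.pos x y := by
  apply F.ext_axes
  · rw [unfold_axis, pos_axis, max_eq_left hx]
  · rw [unfold_axis₂, pos_axis₂]
  · rw [unfold_axis₃, pos_axis₃, max_eq_right (by linarith), mul_zero, add_zero]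

theorem continuous_unfold : Continuous fun q : ℝ × ℝ => F.unfold q.1 q.2 := by
  unfold unfold
  refine (PiLp.continuous_toLp 2 _).comp (continuous_pi fun m => ?_)
  split_ifs <;> fun_prop

theorem continuous_pos : Continuous fun q : ℝ × ℝ => F.pos q.1 q.2 := by
  unfold pos
  refine (PiLp.continuous_toLp 2 _).comp (continuous_pi fun m => ?_)
  split_ifs <;> fun_prop

theorem pos_line_apply (x y v₁ v₂ τ : ℝ) (m : Fin 3) :
    F.pos (x + τ * v₁) (y + τ * v₂) m = F.pos x y m + τ * (F.pos v₁ v₂ m - F.pos 0 0 m) := by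
  simp only [pos]
  split_ifs <;> ring

theorem pos_line_eq_of_germ {F G : Frame} {x y v₁ v₂ x' y' v₁' v₂' t : ℝ}
    (h : ∀ᶠ s in 𝓝[<] t, F.pos (x + (s - t) * v₁) (y + (s - t) * v₂) =
      G.pos (x' + (s - t) * v₁') (y' + (s - t) * v₂')) (s : ℝ) :
    F.pos (x + (s - t) * v₁) (y + (s - t) * v₂) =
      G.pos (x' + (s - t) * v₁') (y' + (s - t) * v₂') := by
  ext m
  have := affine_germ_unique (a := F.pos x y m) (b := F.pos v₁ v₂ m - F.pos 0 0 m)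
    (a' := G.pos x' y' m) (b' := G.pos v₁' v₂' m - G.pos 0 0 m) (t := t) <| by
      filter_upwards [h] with s hs
      rw [← pos_line_apply, ← pos_line_apply, hs]
  rw [pos_line_apply, pos_line_apply, this.1, this.2]

theorem pos_flip (x y : ℝ) : F.flip.pos x (1 - y) = F.pos x y := by
  have h1 := F.axis_ne_axis₂
  have h3 := F.axis₂_ne_axis₃
  apply F.ext_axes
  · have := F.flip.pos_axis x (1 - y)
    rw [pos_axis]
    refine this.trans ?_
    simp only [flip, Pi.add_apply, Pi.single_eq_of_ne h1, add_zero]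
  · have := F.flip.pos_axis₂ x (1 - y)
    rw [axis₂_flip] at this
    rw [this, pos_axis₂]
    simp only [flip, Pi.add_apply, Pi.single_eq_same]
    push_cast; ring
  · have := F.flip.pos_axis₃ x (1 - y)
    rw [axis₃_flip] at this
    rw [this, pos_axis₃]
    simp only [flip, Pi.add_apply, Pi.single_eq_of_ne h3.symm, add_zero]

end Frame

/-! ### Local continuation of geodesics -/

section
variable {γ : ℝ → surface}

/-- The chart is normalised, by exchanging the two squares if need be, so that the point lies in the
square of the frame or on the common edge. -/
theorem IsGeodesic.exists_chart (hγ : IsGeodesic γ) (t : ℝ) :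
    ∃ F : Frame, F.OnSurface ∧ ∃ x y v₁ v₂ : ℝ, 0 ≤ x ∧ x < 1 ∧ 0 < y ∧ y < 1 ∧
      (v₁ ≠ 0 ∨ v₂ ≠ 0) ∧
      ∀ᶠ s in 𝓝 t, (γ s : E3) = F.unfold (x + (s - t) * v₁) (y + (s - t) * v₂) := by
  obtain ⟨a, u, u', w, h, p, v, hv, ε, hε, H⟩ := hγ t
  obtain ⟨F, hF, hfold⟩ := h.exists_frame
  have hp := (H t ⟨by linarith, by linarith⟩).1
  simp only [sub_self, zero_smul, add_zero, chartDomain, Set.mem_prod, Set.mem_Ioo] at hp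
  have hev : ∀ᶠ s in 𝓝 t, (γ s : E3) = F.unfold (p.1 + (s - t) * v.1) (p.2 + (s - t) * v.2) := by
    filter_upwards [Ioo_mem_nhds (show t - ε < t by linarith) (show t < t + ε by linarith)]
      with s hs
    rw [(H s hs).2, hfold]; simp
  have hv' : v.1 ≠ 0 ∨ v.2 ≠ 0 := by
    by_contra! h
    exact hv (Prod.ext h.1 h.2)
  rcases le_total 0 p.1 with h0 | h0
  · exact ⟨F, hF, p.1, p.2, v.1, v.2, h0, hp.1.2, hp.2.1, hp.2.2, hv', hev⟩
  · refine ⟨F.mirror, hF.mirror, -p.1, p.2, -v.1, v.2, by linarith, by linarith, hp.2.1, hp.2.2,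
      by simpa using hv', ?_⟩
    filter_upwards [hev] with s hs
    rw [hs, Frame.unfold_mirror]; congr 1; ring

theorem IsGeodesic.continuous (hγ : IsGeodesic γ) : Continuous fun s => (γ s : E3) := by
  refine continuous_iff_continuousAt.2 fun t => ?_
  obtain ⟨F, -, x, y, v₁, v₂, -, -, -, -, -, hev⟩ := hγ.exists_chart t
  refine ContinuousAt.congr ?_ (EventuallyEq.symm hev)
  exact (F.continuous_unfold.comp (f := fun s => (x + (s - t) * v₁, y + (s - t) * v₂))
    (by fun_prop)).continuousAt

theorem IsGeodesic.eq_pos_of_germ (hγ : IsGeodesic γ) {G : Frame} {x y v₁ v₂ t : ℝ}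
    (h : ∀ᶠ s in 𝓝[<] t, (γ s : E3) = G.pos (x + (s - t) * v₁) (y + (s - t) * v₂)) :
    (γ t : E3) = G.pos x y := by
  have h1 : Tendsto (fun s => (γ s : E3)) (𝓝[<] t) (𝓝 (γ t)) :=
    (hγ.continuous.tendsto t).mono_left nhdsWithin_le_nhds
  have h2 : Tendsto (fun s => G.pos (x + (s - t) * v₁) (y + (s - t) * v₂)) (𝓝[<] t)
      (𝓝 (G.pos x y)) := by
    have := ((G.continuous_pos.comp (f := fun s => (x + (s - t) * v₁, y + (s - t) * v₂))
      (by fun_prop)).tendsto t)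
    simp only [Function.comp, sub_self, zero_mul, add_zero] at this
    exact this.mono_left nhdsWithin_le_nhds
  exact tendsto_nhds_unique (h1.congr' h) h2

/-- A geodesic avoids the integer points: every chart point has a nonintegral coordinate. -/
theorem IsGeodesic.ne_integral (hγ : IsGeodesic γ) (t : ℝ) (n : Fin 3 → ℤ) :
    ¬ ∀ m, (γ t : E3) m = n m := by
  obtain ⟨F, -, x, y, v₁, v₂, -, -, hy, hy', -, hev⟩ := hγ.exists_chart t
  intro h
  have h1 := hev.self_of_nhds
  simp only [sub_self, zero_mul, add_zero] at h1
  have h2 := h F.axis₂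
  rw [h1, F.unfold_axis₂] at h2
  exact add_unit_mul_ne_int _ _ _ hy hy' h2

/-- A geodesic continues straight at inner points of a square. Such a point has two nonintegral
coordinates, so it is not on the folding line of its chart, where the chart is affine. -/
theorem IsGeodesic.eventually_of_interior (hγ : IsGeodesic γ) {G : Frame} {x y v₁ v₂ t : ℝ}
    (hx : 0 < x) (hx' : x < 1) (hy : 0 < y) (hy' : y < 1)
    (h : ∀ᶠ s in 𝓝[<] t, (γ s : E3) = G.pos (x + (s - t) * v₁) (y + (s - t) * v₂)) :
    ∀ᶠ s in 𝓝 t, (γ s : E3) = G.pos (x + (s - t) * v₁) (y + (s - t) * v₂) := by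
  obtain ⟨F, -, x', y', w₁, w₂, hx0, hx1, hy0, hy1, -, hev⟩ := hγ.exists_chart t
  have ht := hγ.eq_pos_of_germ h
  rcases hx0.eq_or_lt with rfl | hx0
  · exfalso
    have h1 := hev.self_of_nhds
    simp only [sub_self, zero_mul, add_zero] at h1
    rw [ht] at h1
    have key : ∀ m k : ℤ, (G.pos x y F.axis ≠ m) ∨ G.pos x y F.axis₃ ≠ k := by
      intro m k
      rcases G.eq_axis F.axis with h2 | h2 | h2
      · exact Or.inl (by rw [h2, G.pos_axis]; exact add_unit_mul_ne_int _ _ _ hx hx')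
      · exact Or.inl (by rw [h2, G.pos_axis₂]; exact add_unit_mul_ne_int _ _ _ hy hy')
      · rcases G.eq_axis F.axis₃ with h3 | h3 | h3
        · exact Or.inr (by rw [h3, G.pos_axis]; exact add_unit_mul_ne_int _ _ _ hx hx')
        · exact Or.inr (by rw [h3, G.pos_axis₂]; exact add_unit_mul_ne_int _ _ _ hy hy')
        · exact absurd (h2.trans h3.symm) F.axis_ne_axis₃
    rcases key (F.corner F.axis) (F.corner F.axis₃) with h2 | h2
    · exact h2 (by rw [h1, F.unfold_axis]; simp)
    · exact h2 (by rw [h1, F.unfold_axis₃]; simp)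
  · have hpos : ∀ᶠ s in 𝓝 t, (γ s : E3) = F.pos (x' + (s - t) * w₁) (y' + (s - t) * w₂) := by
      have : ∀ᶠ s in 𝓝 t, 0 < x' + (s - t) * w₁ := by
        have hc : ContinuousAt (fun s => x' + (s - t) * w₁) t := by fun_prop
        exact hc.eventually (lt_mem_nhds (by simpa using hx0))
      filter_upwards [hev, this] with s hs hs'
      rw [hs, F.unfold_of_nonneg hs'.le]
    have := Frame.pos_line_eq_of_germ (F := F) (G := G) (x := x') (y := y') (v₁ := w₁) (v₂ := w₂)
      (x' := x) (y' := y) (v₁' := v₁) (v₂' := v₂) (t := t) <| by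
        filter_upwards [h, hpos.filter_mono nhdsWithin_le_nhds] with s h1 h2
        rw [← h1, ← h2]
    filter_upwards [hpos] with s hs
    rw [hs, this]

/-- At an inner point of an edge parallel to the second side of `G`, the geodesic has a chart whose
common edge is this edge with the same direction and parametrisation, and whose axes are those of
`G`. -/
theorem IsGeodesic.exists_chart_of_edge (hγ : IsGeodesic γ) {G : Frame} {t y : ℝ} {a b : ℤ}
    (hy : 0 < y) (hy' : y < 1) (h₁ : (γ t : E3) G.axis = a)
    (h₂ : (γ t : E3) G.axis₂ = G.corner G.axis₂ + (G.sign₂ : ℤ) * y)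
    (h₃ : (γ t : E3) G.axis₃ = b) :
    ∃ F : Frame, F.OnSurface ∧ F.axis = G.axis ∧ F.axis₂ = G.axis₂ ∧ F.axis₃ = G.axis₃ ∧
      F.sign₂ = G.sign₂ ∧ F.corner F.axis = a ∧ F.corner F.axis₂ = G.corner F.axis₂ ∧
      F.corner F.axis₃ = b ∧ ∃ v₁ v₂ : ℝ, (v₁ ≠ 0 ∨ v₂ ≠ 0) ∧
      ∀ᶠ s in 𝓝 t, (γ s : E3) = F.unfold ((s - t) * v₁) (y + (s - t) * v₂) := by
  obtain ⟨F, hF, x', y', w₁, w₂, hx0, hx1, hy0, hy1, hw, hev⟩ := hγ.exists_chart t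
  have ht := hev.self_of_nhds
  simp only [sub_self, zero_mul, add_zero] at ht
  have hG : ∀ m, m ≠ G.axis₂ → ∃ k : ℤ, (γ t : E3) m = k := fun m hm => by
    rcases G.eq_axis m with h | h | h
    · exact ⟨a, h ▸ h₁⟩
    · exact absurd h hm
    · exact ⟨b, h ▸ h₃⟩
  have hF2 : F.axis₂ = G.axis₂ := by
    by_contra h
    obtain ⟨k, hk⟩ := hG _ h
    rw [ht, F.unfold_axis₂] at hk
    exact add_unit_mul_ne_int _ _ _ hy0 hy1 hk
  obtain rfl | hx0 := hx0.eq_or_lt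
  swap
  · exfalso
    obtain ⟨k, hk⟩ := hG F.axis (hF2 ▸ F.axis_ne_axis₂)
    rw [ht, F.unfold_axis, max_eq_left hx0.le] at hk
    exact add_unit_mul_ne_int _ _ _ hx0 hx1 hk
  simp only [zero_add] at hev
  -- exchange the two squares of the hinge, if need be
  obtain ⟨F, hF, hF1, hF2, w₁, hw, hev⟩ : ∃ F : Frame, F.OnSurface ∧ F.axis = G.axis ∧
      F.axis₂ = G.axis₂ ∧ ∃ w₁ : ℝ, (w₁ ≠ 0 ∨ w₂ ≠ 0) ∧
      ∀ᶠ s in 𝓝 t, (γ s : E3) = F.unfold ((s - t) * w₁) (y' + (s - t) * w₂) := by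
    rcases G.eq_axis F.axis with h | h | h
    · exact ⟨F, hF, h, hF2, w₁, hw, hev⟩
    · exact absurd (h.trans hF2.symm) F.axis_ne_axis₂
    · refine ⟨F.mirror, hF.mirror, ?_, F.axis₂_mirror.trans hF2, -w₁, by simpa using hw, ?_⟩
      · rcases G.eq_axis F.axis₃ with h' | h' | h'
        · exact h'
        · exact absurd (h'.trans hF2.symm) F.axis₂_ne_axis₃.symm
        · exact absurd (h.trans h'.symm) F.axis_ne_axis₃
      · filter_upwards [hev] with s hs
        rw [hs, Frame.unfold_mirror]; congr 1; ring
  -- reverse the common edge, if need be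
  obtain ⟨F, hF, hF1, hF2, hs, y', hy0, hy1, w₂, hw, hev⟩ : ∃ F : Frame, F.OnSurface ∧
      F.axis = G.axis ∧ F.axis₂ = G.axis₂ ∧ F.sign₂ = G.sign₂ ∧ ∃ y' : ℝ, 0 < y' ∧ y' < 1 ∧
      ∃ w₂ : ℝ, (w₁ ≠ 0 ∨ w₂ ≠ 0) ∧
      ∀ᶠ s in 𝓝 t, (γ s : E3) = F.unfold ((s - t) * w₁) (y' + (s - t) * w₂) := by
    rcases eq_or_ne F.sign₂ G.sign₂ with h | h
    · exact ⟨F, hF, hF1, hF2, h, y', hy0, hy1, w₂, hw, hev⟩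
    · refine ⟨F.flip, hF.flip, hF1, F.axis₂_flip.trans hF2, ?_, 1 - y', by linarith, by linarith,
        -w₂, by simpa using hw, ?_⟩
      · change -F.sign₂ = _
        exact (Int.units_ne_iff_eq_neg.1 h.symm).symm
      · filter_upwards [hev] with s hs
        rw [hs, Frame.unfold_flip]; congr 1; ring
  have hF3 : F.axis₃ = G.axis₃ := by
    rcases G.eq_axis F.axis₃ with h' | h' | h'
    · exact absurd (hF1.trans h'.symm) F.axis_ne_axis₃
    · exact absurd (hF2.trans h'.symm) F.axis₂_ne_axis₃
    · exact h'
  have ht := hev.self_of_nhds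
  simp only [sub_self, zero_mul, add_zero] at ht
  rw [← hF1, ht, F.unfold_axis] at h₁
  rw [← hF2, ht, F.unfold_axis₂, ← hs] at h₂
  rw [← hF3, ht, F.unfold_axis₃] at h₃
  simp only [neg_zero, max_self, mul_zero, add_zero] at h₁ h₃
  obtain ⟨h4, rfl⟩ := eq_of_add_unit_mul_eq hy0 hy1 hy.le hy' h₂
  exact ⟨F, hF, hF1, hF2, hF3, hs, Int.cast_injective h₁, h4, Int.cast_injective h₃, w₁, w₂, hw,
    hev⟩

/-- A geodesic that reaches an inner point of the right edge continues in the next square. The chart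
at the edge must fold `G` onto its neighbour, as the coordinate sums at the corners determine the
signs of all sides. -/
theorem IsGeodesic.eventually_right (hγ : IsGeodesic γ) {G : Frame} (hG : G.OnSurface)
    {y v₁ v₂ t : ℝ} (hy : 0 < y) (hy' : y < 1) (hv : 0 < v₁)
    (h : ∀ᶠ s in 𝓝[<] t, (γ s : E3) = G.pos (1 + (s - t) * v₁) (y + (s - t) * v₂)) :
    ∀ᶠ s in 𝓝[≥] t, (γ s : E3) = G.right.pos ((s - t) * v₁) (y + (s - t) * v₂) := by
  have ht := hγ.eq_pos_of_germ h
  obtain ⟨F, hF, e1, e2, e3, hs, c1, c2, c3, w₁, w₂, -, hev⟩ := hγ.exists_chart_of_edge (G := G)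
    (a := G.corner G.axis + G.sign₁) (b := G.corner G.axis₃) hy hy'
    (by rw [ht, G.pos_axis]; simp) (by rw [ht, G.pos_axis₂]) (by rw [ht, G.pos_axis₃])
  -- both corners satisfy the condition on the coordinate sum, and they differ by the first side
  have hs1 : F.sign₁ = -G.sign₁ := by
    unfold Frame.OnSurface at hF hG
    rw [F.sum_axes, c1, c2, c3, hs] at hF
    rw [G.sum_axes] at hG
    rw [← e2] at hG
    exact Units.ext (by push_cast; linarith)
  have hcoord : ∀ᶠ s in 𝓝[<] t, max ((s - t) * w₁) 0 = (t - s) * v₁ ∧ w₂ = v₂ ∧ s < t := by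
    filter_upwards [h, hev.filter_mono nhdsWithin_le_nhds, self_mem_nhdsWithin] with s h1 h2 h3
    have h3 : s < t := h3
    rw [h1] at h2
    have k1 := congrArg (fun z : E3 => z F.axis) h2
    have k2 := congrArg (fun z : E3 => z F.axis₂) h2
    simp only [F.unfold_axis, F.unfold_axis₂] at k1 k2
    rw [e1, G.pos_axis, ← e1, c1, hs1] at k1
    rw [e2, G.pos_axis₂, ← e2, c2, hs] at k2
    have hne : ((G.sign₁ : ℤ) : ℝ) ≠ 0 := by
      rcases Int.units_eq_one_or G.sign₁ with h | h <;> simp [h]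
    have hne2 : ((G.sign₂ : ℤ) : ℝ) ≠ 0 := by
      rcases Int.units_eq_one_or G.sign₂ with h | h <;> simp [h]
    refine ⟨mul_left_cancel₀ hne ?_, ?_, h3⟩
    · rw [e1] at k1
      push_cast at k1; linarith
    · have := mul_left_cancel₀ hne2 (add_left_cancel k2)
      exact mul_left_cancel₀ (sub_ne_zero.2 h3.ne) (add_left_cancel this.symm)
  obtain ⟨s₀, hm, hw2, hs0⟩ := hcoord.exists
  have hw1 : w₁ = -v₁ := by
    have hpos : 0 < (t - s₀) * v₁ := mul_pos (by linarith) hv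
    rw [max_def] at hm
    split_ifs at hm with h1
    · linarith
    · have : (s₀ - t) * w₁ = (s₀ - t) * (-v₁) := by linarith
      exact mul_left_cancel₀ (sub_ne_zero.2 hs0.ne) this
  subst hw1 hw2
  filter_upwards [hev.filter_mono nhdsWithin_le_nhds, self_mem_nhdsWithin] with s h2 h3
  have h3 : t ≤ s := h3
  have hnn : 0 ≤ (s - t) * v₁ := mul_nonneg (by linarith) hv.le
  have h5 := G.axis_ne_axis₂
  have h6 := G.axis_ne_axis₃
  rw [h2]
  apply F.ext_axes
  · have := G.right.pos_axis₃ ((s - t) * v₁) (y + (s - t) * w₂)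
    rw [Frame.axis₃_right, ← e1] at this
    rw [this, F.unfold_axis, max_eq_right (by linarith), c1, mul_zero, add_zero]
    simp [Frame.right, e1]
  · have := G.right.pos_axis₂ ((s - t) * v₁) (y + (s - t) * w₂)
    rw [Frame.axis₂_right, ← e2] at this
    rw [this, F.unfold_axis₂, c2, hs]
    simp only [Frame.right, e2, Pi.add_apply, Pi.single_eq_of_ne h5.symm, add_zero]
  · have : G.right.pos ((s - t) * v₁) (y + (s - t) * w₂) F.axis₃ =
        G.right.corner G.axis₃ + (G.right.sign₁ : ℤ) * ((s - t) * v₁) := by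
      rw [e3]; exact G.right.pos_axis ((s - t) * v₁) (y + (s - t) * w₂)
    rw [this, F.unfold_axis₃, c3, hs1, max_eq_left (by linarith)]
    simp only [Frame.right, Pi.add_apply, Pi.single_eq_of_ne h6.symm, add_zero]
    push_cast; ring

theorem IsGeodesic.eventually_up (hγ : IsGeodesic γ) {G : Frame} (hG : G.OnSurface)
    {x v₁ v₂ t : ℝ} (hx : 0 < x) (hx' : x < 1) (hv : 0 < v₂)
    (h : ∀ᶠ s in 𝓝[<] t, (γ s : E3) = G.pos (x + (s - t) * v₁) (1 + (s - t) * v₂)) :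
    ∀ᶠ s in 𝓝[≥] t, (γ s : E3) = G.up.pos (x + (s - t) * v₁) ((s - t) * v₂) := by
  have := hγ.eventually_right hG.transpose hx hx' hv (v₂ := v₁) (t := t) <| by
    simpa only [Frame.pos_transpose] using h
  simpa only [Frame.transpose_right, Frame.pos_transpose] using this

/-- A geodesic that runs inside an edge stays on this edge. -/
theorem IsGeodesic.eventually_of_edge (hγ : IsGeodesic γ) {G : Frame}
    {y v t : ℝ} (hy : 0 < y) (hy' : y < 1)
    (h : ∀ᶠ s in 𝓝[<] t, (γ s : E3) = G.pos 0 (y + (s - t) * v)) :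
    ∀ᶠ s in 𝓝 t, (γ s : E3) = G.pos 0 (y + (s - t) * v) := by
  have h' : ∀ᶠ s in 𝓝[<] t, (γ s : E3) = G.pos (0 + (s - t) * 0) (y + (s - t) * v) := by
    simpa using h
  have ht := hγ.eq_pos_of_germ h'
  obtain ⟨F, hF, e1, e2, e3, hs, c1, c2, c3, w₁, w₂, -, hev⟩ := hγ.exists_chart_of_edge (G := G)
    (a := G.corner G.axis) (b := G.corner G.axis₃) hy hy'
    (by rw [ht, G.pos_axis]; simp) (by rw [ht, G.pos_axis₂]) (by rw [ht, G.pos_axis₃])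
  -- before the time `t` the geodesic does not leave the folding line
  have hw1 : w₁ = 0 := by
    obtain ⟨s, h1, h2, h3⟩ := (h.and ((hev.filter_mono nhdsWithin_le_nhds).and
      self_mem_nhdsWithin)).exists
    have h3 : s < t := h3
    rw [h1] at h2
    have k1 := congrArg (fun z : E3 => z F.axis) h2
    have k3 := congrArg (fun z : E3 => z F.axis₃) h2
    simp only [F.unfold_axis, F.unfold_axis₃] at k1 k3
    rw [e1, G.pos_axis, ← e1, c1] at k1
    rw [e3, G.pos_axis₃, ← e3, c3] at k3
    have hne : ((F.sign₁ : ℤ) : ℝ) ≠ 0 := by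
      rcases Int.units_eq_one_or F.sign₁ with h | h <;> simp [h]
    rw [mul_zero, add_zero, e1, left_eq_add, mul_eq_zero, or_iff_right hne] at k1
    rw [e3, left_eq_add, mul_eq_zero, or_iff_right hne] at k3
    have : (s - t) * w₁ = 0 := le_antisymm (max_eq_right_iff.1 k1)
      (by have := max_eq_right_iff.1 k3; linarith)
    exact (mul_eq_zero.1 this).resolve_left (sub_ne_zero.2 h3.ne)
  subst hw1
  simp only [mul_zero] at hev
  have := Frame.pos_line_eq_of_germ (F := F) (G := G) (x := 0) (y := y) (v₁ := 0) (v₂ := w₂)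
    (x' := 0) (y' := y) (v₁' := 0) (v₂' := v) (t := t) <| by
      filter_upwards [h, hev.filter_mono nhdsWithin_le_nhds] with s h1 h2
      simp only [mul_zero, add_zero]
      rw [← h1, h2, F.unfold_of_nonneg le_rfl]
  simp only [mul_zero, add_zero] at this
  filter_upwards [hev] with s hs
  rw [hs, F.unfold_of_nonneg le_rfl, this]

/-- A geodesic cannot run along an edge, since it would reach a vertex in finite time. -/
theorem IsGeodesic.not_along_edge (hγ : IsGeodesic γ) {F : Frame} {t y v : ℝ} (hy : 0 < y)
    (hy' : y < 1) (hv : 0 < v) (h : ∀ᶠ s in 𝓝 t, (γ s : E3) = F.pos 0 (y + (s - t) * v)) :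
    False := by
  set T := (1 - y) / v with hT
  have hTpos : 0 < T := div_pos (by linarith) hv
  have hTv : T * v = 1 - y := by rw [hT]; field_simp
  have key : ∀ s ≥ 0, s < T → (γ (t + s) : E3) = F.pos 0 (y + s * v) := by
    refine real_induction ?_ ?_
    · have : ContinuousAt (fun s : ℝ => t + s) 0 := by fun_prop
      have h' := this.eventually (by simpa using h)
      refine Eventually.filter_mono nhdsWithin_le_nhds ?_
      filter_upwards [h'] with s hs _
      simpa using hs
    · intro T' hT' hind
      rcases lt_or_ge T' T with hlt | hge
      · have h1 : ∀ᶠ s in 𝓝[<] (t + T'), (γ s : E3) =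
            F.pos 0 ((y + T' * v) + (s - (t + T')) * v) := by
          filter_upwards [Ico_mem_nhdsLT (show t < t + T' by linarith)] with s hs
          have := hind (s - t) ⟨by linarith [hs.1], by linarith [hs.2]⟩ (by linarith [hs.2])
          rw [show t + (s - t) = s by ring] at this
          rw [this]; congr 1; ring
        have h2 := hγ.eventually_of_edge (by nlinarith) (by nlinarith) h1
        have : ContinuousAt (fun s : ℝ => t + s) T' := by fun_prop
        refine Eventually.filter_mono nhdsWithin_le_nhds ?_
        filter_upwards [this.eventually h2] with s hs _
        rw [hs]; congr 1; ring
      · filter_upwards [self_mem_nhdsWithin] with s hs hs'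
        exact absurd (lt_of_lt_of_le hs' hge) (not_lt.2 hs)
  have h1 : ∀ᶠ s in 𝓝[<] (t + T), (γ s : E3) =
      F.pos (0 + (s - (t + T)) * 0) (1 + (s - (t + T)) * v) := by
    filter_upwards [Ico_mem_nhdsLT (show t < t + T by linarith)] with s hs
    have := key (s - t) (by linarith [hs.1]) (by linarith [hs.2])
    rw [show t + (s - t) = s by ring] at this
    rw [this, mul_zero, add_zero]; congr 1; linarith
  have h2 := hγ.eq_pos_of_germ h1
  refine hγ.ne_integral (t + T) (F.corner + Pi.single F.axis₂ (F.sign₂ : ℤ)) fun m => ?_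
  rw [h2]
  simp only [Frame.pos, Pi.add_apply, Pi.single_apply]
  split_ifs <;> simp

/-- At some time the geodesic is in the interior of a square, and seen from a suitable corner of
it, the components of the velocity are nonnegative. -/
theorem IsGeodesic.exists_interior (hγ : IsGeodesic γ) :
    ∃ (t : ℝ) (F : Frame), F.OnSurface ∧ ∃ x y v₁ v₂ : ℝ, 0 < x ∧ x < 1 ∧ 0 < y ∧ y < 1 ∧
      0 ≤ v₁ ∧ 0 ≤ v₂ ∧ 0 < v₁ + v₂ ∧
      ∀ᶠ s in 𝓝 t, (γ s : E3) = F.pos (x + (s - t) * v₁) (y + (s - t) * v₂) := by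
  obtain ⟨t, F, hF, x, y, v₁, v₂, hx, hx', hy, hy', hv, h⟩ : ∃ (t : ℝ) (F : Frame), F.OnSurface ∧
      ∃ x y v₁ v₂ : ℝ, 0 < x ∧ x < 1 ∧ 0 < y ∧ y < 1 ∧ (v₁ ≠ 0 ∨ v₂ ≠ 0) ∧
      ∀ᶠ s in 𝓝 t, (γ s : E3) = F.pos (x + (s - t) * v₁) (y + (s - t) * v₂) := by
    obtain ⟨F, hF, x, y, v₁, v₂, hx, hx', hy, hy', hv, hev⟩ := hγ.exists_chart 0
    have hpos : ∀ {F : Frame} {x' y' w t : ℝ}, 0 < x' → (∀ᶠ s in 𝓝 t, (γ s : E3) =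
        F.unfold (x' + (s - t) * w) (y' + (s - t) * v₂)) → ∀ᶠ s in 𝓝 t, (γ s : E3) =
        F.pos (x' + (s - t) * w) (y' + (s - t) * v₂) := by
      intro F x' y' w t hx h
      have hc : ContinuousAt (fun s => x' + (s - t) * w) t := by fun_prop
      filter_upwards [h, hc.eventually (lt_mem_nhds (by simpa using hx))] with s hs hs'
      rw [hs, F.unfold_of_nonneg (le_of_lt hs')]
    rcases hx.eq_or_lt with rfl | hx
    swap
    · exact ⟨0, F, hF, x, y, v₁, v₂, hx, hx', hy, hy', hv, hpos hx hev⟩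
    obtain rfl | hv₁ := eq_or_ne v₁ 0
    · exfalso
      have hv : v₂ ≠ 0 := by simpa using hv
      simp only [mul_zero, add_zero, F.unfold_of_nonneg le_rfl] at hev
      rcases lt_or_gt_of_ne hv with hv | hv
      · refine hγ.not_along_edge (F := F.flip) (t := 0) (y := 1 - y) (v := -v₂) (by linarith)
          (by linarith) (by linarith) ?_
        filter_upwards [hev] with s hs
        rw [hs, ← F.pos_flip]; congr 1; ring
      · exact hγ.not_along_edge hy hy' hv hev
    -- from the common edge the geodesic enters one of the two squares
    obtain ⟨F, hF, v₁, hv₁, hev⟩ : ∃ F : Frame, F.OnSurface ∧ ∃ v₁ : ℝ, 0 < v₁ ∧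
        ∀ᶠ s in 𝓝 (0 : ℝ), (γ s : E3) = F.unfold (s * v₁) (y + s * v₂) := by
      simp only [zero_add, sub_zero] at hev
      rcases lt_or_gt_of_ne hv₁ with h | h
      · refine ⟨F.mirror, hF.mirror, -v₁, by linarith, ?_⟩
        filter_upwards [hev] with s hs
        rw [hs, Frame.unfold_mirror]; congr 1; ring
      · exact ⟨F, hF, v₁, h, hev⟩
    have e1 : ∀ᶠ s in 𝓝[>] (0 : ℝ), y + s * v₂ ∈ Set.Ioo 0 1 := by
      have : ContinuousAt (fun s : ℝ => y + s * v₂) 0 := by fun_prop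
      exact (this.eventually (Ioo_mem_nhds (by simpa using hy) (by simpa using hy'))).filter_mono
        nhdsWithin_le_nhds
    have e2 : ∀ᶠ s in 𝓝[>] (0 : ℝ), s * v₁ < 1 := by
      have : ContinuousAt (fun s : ℝ => s * v₁) 0 := by fun_prop
      exact (this.eventually (gt_mem_nhds (by simp))).filter_mono nhdsWithin_le_nhds
    have e3 := (eventually_eventually_nhds.2 hev).filter_mono (nhdsWithin_le_nhds (s := Set.Ioi 0))
    obtain ⟨t, ⟨h1, h2, h3⟩, h4⟩ := ((e1.and (e2.and e3)).and self_mem_nhdsWithin).exists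
    have h4 : 0 < t := h4
    refine ⟨t, F, hF, t * v₁, y + t * v₂, v₁, v₂, by positivity, h2, h1.1, h1.2, Or.inl hv₁.ne',
      hpos (by positivity) ?_⟩
    filter_upwards [h3] with s hs
    rw [hs]; congr 1 <;> ring
  -- pass to the corner of the square from which both components of the velocity are nonnegative
  obtain ⟨F, hF, y, v₂, hy, hy', hv, hv₂, h⟩ : ∃ F : Frame, F.OnSurface ∧ ∃ y v₂ : ℝ, 0 < y ∧
      y < 1 ∧ (v₁ ≠ 0 ∨ v₂ ≠ 0) ∧ 0 ≤ v₂ ∧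
      ∀ᶠ s in 𝓝 t, (γ s : E3) = F.pos (x + (s - t) * v₁) (y + (s - t) * v₂) := by
    rcases le_total 0 v₂ with h0 | h0
    · exact ⟨F, hF, y, v₂, hy, hy', hv, h0, h⟩
    · refine ⟨F.flip, hF.flip, 1 - y, -v₂, by linarith, by linarith, by simpa using hv,
        by linarith, ?_⟩
      filter_upwards [h] with s hs
      rw [hs, ← F.pos_flip]; congr 1; ring
  obtain ⟨F, hF, x, v₁, hx, hx', hv, hv₁, h⟩ : ∃ F : Frame, F.OnSurface ∧ ∃ x v₁ : ℝ, 0 < x ∧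
      x < 1 ∧ (v₁ ≠ 0 ∨ v₂ ≠ 0) ∧ 0 ≤ v₁ ∧
      ∀ᶠ s in 𝓝 t, (γ s : E3) = F.pos (x + (s - t) * v₁) (y + (s - t) * v₂) := by
    rcases le_total 0 v₁ with h0 | h0
    · exact ⟨F, hF, x, v₁, hx, hx', hv, h0, h⟩
    · refine ⟨F.transpose.flip.transpose, hF.transpose.flip.transpose, 1 - x, -v₁, by linarith,
        by linarith, by simpa using hv, by linarith, ?_⟩
      filter_upwards [h] with s hs
      rw [hs, Frame.pos_transpose, ← F.pos_transpose, ← Frame.pos_flip]; congr 1; ring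
  refine ⟨t, F, hF, x, y, v₁, v₂, hx, hx', hy, hy', hv₁, hv₂, ?_, h⟩
  rcases hv with hv | hv
  · exact add_pos_of_pos_of_nonneg (hv₁.lt_of_ne' hv) hv₂
  · exact add_pos_of_nonneg_of_pos hv₁ (hv₂.lt_of_ne' hv)

end

/-! ### Development along a line -/

namespace Frame

/-- The frames met along a line, if `c k` is the column of the cell number `k` that the line
passes: the step from cell `k` to cell `k + 1` leads upwards if the column stays the same, and to
the right otherwise. -/
def develop (F : Frame) (c : ℕ → ℕ) : ℕ → Frame
  | 0 => F
  | k + 1 => if c (k + 1) = c k then (F.develop c k).up else (F.develop c k).right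

theorem OnSurface.develop {F : Frame} (hF : F.OnSurface) (c : ℕ → ℕ) (k : ℕ) :
    (F.develop c k).OnSurface := by
  induction k with
  | zero => exact hF
  | succ k ih =>
    rw [Frame.develop]
    split_ifs
    exacts [ih.up, ih.right]
end Frame

/-- The column of the cell `(i, j)` with `i + j = k` through which the line
`t ↦ (x + t v₁, y + t v₂)` passes. The cell is determined by the condition that its upper left and
its lower right corner lie on different sides of the line. -/
def column (x y v₁ v₂ : ℝ) (k : ℕ) : ℕ := ⌊(v₂ * x + v₁ * (1 - y) + k * v₁) / (v₁ + v₂)⌋₊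

section
variable {x y v₁ v₂ : ℝ}

theorem column_floor_add_floor (hx : 0 < x) (hy : 0 < y) (hy' : y < 1)
    (hv₁ : 0 ≤ v₁) (hv₂ : 0 ≤ v₂) (hv : 0 < v₁ + v₂) {t : ℝ} (ht : 0 ≤ t) :
    column x y v₁ v₂ (⌊x + t * v₁⌋₊ + ⌊y + t * v₂⌋₊) = ⌊x + t * v₁⌋₊ := by
  have hX : 0 ≤ x + t * v₁ := by positivity
  have hY : 0 ≤ y + t * v₂ := by positivity
  have h1 := Nat.floor_le hX
  have h2 := Nat.lt_floor_add_one (x + t * v₁)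
  have h3 := Nat.floor_le hY
  have h4 := Nat.lt_floor_add_one (y + t * v₂)
  have h5 : v₂ = 0 → ⌊y + t * v₂⌋₊ = 0 := by
    rintro rfl
    rw [Nat.floor_eq_zero]; simpa using hy'
  generalize ⌊x + t * v₁⌋₊ = i at *
  generalize ⌊y + t * v₂⌋₊ = j at *
  have hE : v₂ * x + v₁ * (1 - y) = v₂ * (x + t * v₁) + v₁ * (1 - (y + t * v₂)) := by ring
  have hnn : 0 ≤ v₂ * x + v₁ * (1 - y) := by
    have := mul_nonneg hv₂ hx.le
    have := mul_nonneg hv₁ (sub_nonneg.2 hy'.le)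
    linarith
  rw [column, Nat.floor_eq_iff (by positivity), le_div_iff₀ hv, div_lt_iff₀ hv, hE]
  push_cast
  constructor
  · have := mul_nonneg hv₂ (sub_nonneg.2 h1)
    have := mul_nonneg hv₁ (sub_nonneg.2 h4.le)
    linarith
  · rcases hv₂.eq_or_lt with h | h
    · have hj := h5 h.symm
      rw [← h] at hv ⊢
      subst hj
      have := mul_pos (show 0 < v₁ by linarith) hy
      push_cast
      linarith
    · have := mul_pos h (sub_pos.2 h2)
      have := mul_nonneg hv₁ (sub_nonneg.2 h3)
      linarith

/-- The floor is locally constant where the argument is not an integer. -/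
theorem eventually_floor_eq {a b t : ℝ} {n : ℕ} (h : (n : ℝ) < a + t * b) (h' : a + t * b < n + 1) :
    ∀ᶠ s in 𝓝 t, ⌊a + s * b⌋₊ = n := by
  have hc : ContinuousAt (fun s => a + s * b) t := by fun_prop
  filter_upwards [hc.eventually (Ioo_mem_nhds h h')] with s hs
  exact (Nat.floor_eq_iff (n.cast_nonneg.trans hs.1.le)).2 ⟨hs.1.le, hs.2⟩

theorem eventually_floor_eq_right {a b t : ℝ} {n : ℕ} (hb : 0 ≤ b) (h : (n : ℝ) ≤ a + t * b)
    (h' : a + t * b < n + 1) : ∀ᶠ s in 𝓝[≥] t, ⌊a + s * b⌋₊ = n := by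
  have hc : ContinuousAt (fun s => a + s * b) t := by fun_prop
  filter_upwards [(hc.eventually (gt_mem_nhds h')).filter_mono nhdsWithin_le_nhds,
    self_mem_nhdsWithin] with s hs hs'
  have : (n : ℝ) ≤ a + s * b := h.trans (by have := mul_le_mul_of_nonneg_right hs' hb; linarith)
  exact (Nat.floor_eq_iff (n.cast_nonneg.trans this)).2 ⟨this, hs⟩

theorem eventually_floor_eq_left {a b t : ℝ} {n : ℕ} (hb : 0 < b) (h : a + t * b = n + 1) :
    ∀ᶠ s in 𝓝[<] t, ⌊a + s * b⌋₊ = n := by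
  have hc : ContinuousAt (fun s => a + s * b) t := by fun_prop
  have h1 : (n : ℝ) < a + t * b := by linarith
  filter_upwards [(hc.eventually (lt_mem_nhds h1)).filter_mono nhdsWithin_le_nhds,
    self_mem_nhdsWithin] with s hs hs'
  have : a + s * b < n + 1 := by have := mul_lt_mul_of_pos_right hs' hb; linarith
  exact (Nat.floor_eq_iff (n.cast_nonneg.trans hs.le)).2 ⟨hs.le, this⟩

variable {γ : ℝ → surface}

/-- The geodesic is the image of a straight line: at time `t ≥ 0` the line is in the cell given by
the floors of its coordinates, and the geodesic is at the same place in the frame of this cell. -/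
theorem IsGeodesic.eq_develop (hγ : IsGeodesic γ) {F : Frame} (hF : F.OnSurface)
    (hx : 0 < x) (hx' : x < 1) (hy : 0 < y) (hy' : y < 1)
    (hv₁ : 0 ≤ v₁) (hv₂ : 0 ≤ v₂) (hv : 0 < v₁ + v₂)
    (h : ∀ᶠ s in 𝓝 0, (γ s : E3) = F.pos (x + s * v₁) (y + s * v₂)) :
    ∀ t ≥ 0, (γ t : E3) =
      (F.develop (column x y v₁ v₂) (⌊x + t * v₁⌋₊ + ⌊y + t * v₂⌋₊)).pos
        (x + t * v₁ - ⌊x + t * v₁⌋₊) (y + t * v₂ - ⌊y + t * v₂⌋₊) := by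
  set c := column x y v₁ v₂ with hc
  have hcol : ∀ {t : ℝ}, 0 ≤ t → c (⌊x + t * v₁⌋₊ + ⌊y + t * v₂⌋₊) = ⌊x + t * v₁⌋₊ :=
    fun ht => column_floor_add_floor hx hy hy' hv₁ hv₂ hv ht
  refine real_induction ?_ fun T hT hind => ?_
  · refine Eventually.filter_mono nhdsWithin_le_nhds ?_
    filter_upwards [h, eventually_floor_eq (a := x) (b := v₁) (t := 0) (n := 0) (by simpa using hx)
      (by simpa using hx'), eventually_floor_eq (a := y) (b := v₂) (t := 0) (n := 0)
      (by simpa using hy) (by simpa using hy')] with s hs h1 h2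
    rw [hs, h1, h2]
    simp [Frame.develop]
  have hX : 0 < x + T * v₁ := by positivity
  have hY : 0 < y + T * v₂ := by positivity
  -- the cells just before and just after the time `T`
  have hleft : ∀ {a b : ℝ}, 0 ≤ b → 0 < a → a < 1 → ∃ n : ℕ, (∀ᶠ s in 𝓝[<] T, ⌊a + s * b⌋₊ = n) ∧
      ((n : ℝ) < a + T * b ∧ a + T * b < n + 1 ∧ (∀ᶠ s in 𝓝[≥] T, ⌊a + s * b⌋₊ = n) ∨
        0 < b ∧ a + T * b = n + 1 ∧ (∀ᶠ s in 𝓝[≥] T, ⌊a + s * b⌋₊ = n + 1)) := by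
    intro a b hb ha ha'
    have hA : 0 < a + T * b := by positivity
    have h1 := Nat.floor_le hA.le
    have h2 := Nat.lt_floor_add_one (a + T * b)
    rcases h1.eq_or_lt with h3 | h3
    · have hn : ⌊a + T * b⌋₊ ≠ 0 := by
        intro h0; rw [h0] at h3; simp at h3; linarith
      obtain ⟨n, hn⟩ := Nat.exists_eq_succ_of_ne_zero hn
      rw [hn] at h3 h2
      push_cast at h3 h2
      have hb' : 0 < b := by
        refine hb.lt_of_ne' ?_
        rintro rfl
        have h5 : ((n + 1 : ℕ) : ℝ) < 1 := by push_cast; linarith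
        have : n + 1 < 1 := by exact_mod_cast h5
        omega
      refine ⟨n, eventually_floor_eq_left hb' h3.symm, Or.inr ⟨hb', h3.symm, ?_⟩⟩
      exact eventually_floor_eq_right hb (by push_cast; exact h3.le) (by push_cast; exact h2)
    · exact ⟨_, (eventually_floor_eq h3 h2).filter_mono nhdsWithin_le_nhds,
        Or.inl ⟨h3, h2, (eventually_floor_eq h3 h2).filter_mono nhdsWithin_le_nhds⟩⟩
  obtain ⟨i, hi, hi'⟩ := hleft hv₁ hx hx'
  obtain ⟨j, hj, hj'⟩ := hleft hv₂ hy hy'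
  set G := F.develop c (i + j) with hGdef
  have hG : G.OnSurface := hF.develop c _
  have hpast : ∀ᶠ s in 𝓝[<] T, (0 ≤ s ∧ c (i + j) = i) ∧ (γ s : E3) =
      G.pos ((x + T * v₁ - i) + (s - T) * v₁) ((y + T * v₂ - j) + (s - T) * v₂) := by
    filter_upwards [hi, hj, Ico_mem_nhdsLT hT] with s h1 h2 hs
    have h3 := hcol hs.1
    have h4 := hind s hs
    rw [h1, h2] at h3 h4
    refine ⟨⟨hs.1, h3⟩, ?_⟩
    rw [h4]; congr 1 <;> ring
  obtain ⟨-, ⟨-, hcij⟩, -⟩ := hpast.exists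
  replace hpast := hpast.mono fun _ h => h.2
  have hge : ∀ᶠ s in 𝓝[≥] T, 0 ≤ s := by
    filter_upwards [self_mem_nhdsWithin] with s hs
    exact hT.le.trans hs
  rcases hi' with ⟨i1, i2, i3⟩ | ⟨i1, i2, i3⟩ <;> rcases hj' with ⟨j1, j2, j3⟩ | ⟨j1, j2, j3⟩
  · filter_upwards [(hγ.eventually_of_interior (by linarith) (by linarith) (by linarith)
      (by linarith) hpast).filter_mono nhdsWithin_le_nhds, i3, j3] with s hs h1 h2
    rw [h1, h2, hs]; congr 1 <;> ring
  · have hy1 : y + T * v₂ - j = 1 := by linarith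
    rw [hy1] at hpast
    have := hγ.eventually_up hG (by linarith) (by linarith) j1 hpast
    filter_upwards [this, i3, j3, hge] with s hs h1 h2 h3
    have h4 := hcol h3
    rw [h1, h2] at h4
    rw [h1, h2, hs]
    have : F.develop c (i + (j + 1)) = G.up := by
      rw [← add_assoc, Frame.develop, if_pos]
      rw [hcij]; exact h4
    rw [this]; congr 1
    · ring
    · push_cast; linarith
  · have hx1 : x + T * v₁ - i = 1 := by linarith
    rw [hx1] at hpast
    have := hγ.eventually_right hG (by linarith) (by linarith) i1 hpast
    filter_upwards [this, i3, j3, hge] with s hs h1 h2 h3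
    have h4 := hcol h3
    rw [h1, h2, add_right_comm] at h4
    rw [h1, h2, hs]
    have : F.develop c (i + 1 + j) = G.right := by
      rw [add_right_comm, Frame.develop, if_neg]
      rw [hcij, h4]; omega
    rw [this]; congr 1
    · push_cast; linarith
    · ring
  · -- the geodesic would run into a vertex
    exfalso
    have h2 := hγ.eq_pos_of_germ hpast
    refine hγ.ne_integral T (G.corner + Pi.single G.axis (G.sign₁ : ℤ) +
      Pi.single G.axis₂ (G.sign₂ : ℤ)) fun m => ?_
    rw [h2, i2, j2]
    simp only [Frame.pos, Pi.add_apply, Pi.single_apply]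
    split_ifs <;> push_cast <;> ring

end

/-! ### The frame is determined by the motion -/

theorem units_cast_injective {a b : ℤˣ} (h : ((a : ℤ) : Fin 3) = ((b : ℤ) : Fin 3)) : a = b := by
  rcases Int.units_eq_one_or a with rfl | rfl <;> rcases Int.units_eq_one_or b with rfl | rfl <;>
    first | rfl | exact absurd h (by decide)

/-- Two frames of the same orientation in which the same motion has the same nonnegative velocity
are equal. The nonintegral coordinates show the axes up to an exchange, and the exchange would
reverse the orientation. -/
theorem Frame.eq_of_germ {F G : Frame} (ho : F.orientation = G.orientation) {x y x' y' v₁ v₂ : ℝ}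
    (hx : 0 < x) (hx1 : x < 1) (hy : 0 < y) (hy1 : y < 1) (hx' : 0 ≤ x') (hx1' : x' < 1)
    (hy' : 0 ≤ y') (hy1' : y' < 1) (hv₁ : 0 ≤ v₁) (hv₂ : 0 ≤ v₂) (hv : 0 < v₁ + v₂)
    {τ : ℝ} (hτ : τ ≠ 0) (h0 : F.pos x y = G.pos x' y')
    (h1 : F.pos (x + τ * v₁) (y + τ * v₂) = G.pos (x' + τ * v₁) (y' + τ * v₂)) :
    F = G ∧ x = x' ∧ y = y' := by
  have hd : ∀ m, F.pos v₁ v₂ m - F.pos 0 0 m = G.pos v₁ v₂ m - G.pos 0 0 m := fun m => by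
    have h2 := congrArg (fun z : E3 => z m) h1
    simp only [F.pos_line_apply, G.pos_line_apply, h0] at h2
    exact mul_left_cancel₀ hτ (add_left_cancel h2)
  have hF1 : F.axis ≠ G.axis₃ := by
    intro h
    have := congrArg (fun z : E3 => z F.axis) h0
    simp only [F.pos_axis] at this
    rw [h, G.pos_axis₃] at this
    exact add_unit_mul_ne_int _ _ _ hx hx1 this
  have hF2 : F.axis₂ ≠ G.axis₃ := by
    intro h
    have := congrArg (fun z : E3 => z F.axis₂) h0
    simp only [F.pos_axis₂] at this
    rw [h, G.pos_axis₃] at this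
    exact add_unit_mul_ne_int _ _ _ hy hy1 this
  have hu : ∀ s : ℤˣ, ((s : ℤ) : ℝ) = 1 ∨ ((s : ℤ) : ℝ) = -1 := fun s => by
    rcases Int.units_eq_one_or s with h | h <;> simp [h]
  have hdF₁ := hd F.axis
  have hdF₂ := hd F.axis₂
  simp only [F.pos_axis, F.pos_axis₂] at hdF₁ hdF₂
  have hinj : ∀ {s t : ℤˣ}, ((s : ℤ) : ℝ) = (t : ℤ) → s = t := fun h =>
    Units.ext (Int.cast_injective (α := ℝ) h)
  have hturn : ∀ {F : Frame}, F.axis₂ - F.axis = F.turn := by simp [axis₂]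
  rcases G.eq_axis F.axis with e1 | e1 | e1
  · have e2 : F.axis₂ = G.axis₂ := by
      rcases G.eq_axis F.axis₂ with e2 | e2 | e2
      · exact absurd (e1.trans e2.symm) F.axis_ne_axis₂
      · exact e2
      · exact absurd e2 hF2
    rw [e1, G.pos_axis, G.pos_axis] at hdF₁
    rw [e2, G.pos_axis₂, G.pos_axis₂] at hdF₂
    have ht : F.turn = G.turn := by rw [← hturn, ← hturn, e1, e2]
    have hst : F.sign₁ * F.sign₂ = G.sign₁ * G.sign₂ := by
      have := units_cast_injective ht
      rw [mul_assoc, mul_assoc, ho] at this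
      exact mul_left_cancel this
    have hs : F.sign₁ = G.sign₁ ∧ F.sign₂ = G.sign₂ := by
      rcases hv₁.eq_or_lt with h | h
      · have : F.sign₂ = G.sign₂ := hinj (mul_right_cancel₀ (show v₂ ≠ 0 by linarith) (by linarith))
        rw [this] at hst
        exact ⟨mul_right_cancel hst, this⟩
      · have : F.sign₁ = G.sign₁ := hinj (mul_right_cancel₀ h.ne' (by linarith))
        rw [this] at hst
        exact ⟨this, mul_left_cancel hst⟩
    have k1 := congrArg (fun z : E3 => z F.axis) h0
    have k2 := congrArg (fun z : E3 => z F.axis₂) h0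
    have k3 := congrArg (fun z : E3 => z F.axis₃) h0
    have e3 : F.axis₃ = G.axis₃ := by unfold axis₃; rw [e1, ht]
    simp only [F.pos_axis, F.pos_axis₂, F.pos_axis₃] at k1 k2 k3
    rw [e1, G.pos_axis, hs.1] at k1
    rw [e2, G.pos_axis₂, hs.2] at k2
    rw [e3, G.pos_axis₃] at k3
    obtain ⟨c1, rfl⟩ := eq_of_add_unit_mul_eq hx hx1 hx' hx1' k1
    obtain ⟨c2, rfl⟩ := eq_of_add_unit_mul_eq hy hy1 hy' hy1' k2
    refine ⟨Frame.ext ?_ e1 hs.1 hs.2 ho, rfl, rfl⟩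
    ext m
    rcases G.eq_axis m with h | h | h <;> rw [h]
    exacts [c1, c2, Int.cast_injective (α := ℝ) k3]
  · exfalso
    have e2 : F.axis₂ = G.axis := by
      rcases G.eq_axis F.axis₂ with e2 | e2 | e2
      · exact e2
      · exact absurd (e1.trans e2.symm) F.axis_ne_axis₂
      · exact absurd e2 hF2
    rw [e1, G.pos_axis₂, G.pos_axis₂] at hdF₁
    rw [e2, G.pos_axis, G.pos_axis] at hdF₂
    have ht : F.turn = -G.turn := by rw [← hturn, ← hturn, e1, e2]; ring
    have hst : F.sign₁ * F.sign₂ = -(G.sign₁ * G.sign₂) := by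
      have : F.orientation * F.sign₁ * F.sign₂ = -(G.orientation * G.sign₁ * G.sign₂) :=
        units_cast_injective (ht.trans (by simp [turn]))
      rw [mul_assoc, mul_assoc, ho, ← mul_neg] at this
      exact mul_left_cancel this
    have hvv : v₁ = v₂ := by
      rcases hu F.sign₁ with h1 | h1 <;> rcases hu G.sign₂ with h2 | h2 <;> rw [h1, h2] at hdF₁ <;>
        rcases hu F.sign₂ with h3 | h3 <;> rcases hu G.sign₁ with h4 | h4 <;>
        rw [h3, h4] at hdF₂ <;> linarith
    subst hvv
    have s1 : F.sign₁ = G.sign₂ :=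
      hinj (mul_right_cancel₀ (show v₁ ≠ 0 by linarith) (by linarith))
    have s2 : F.sign₂ = G.sign₁ :=
      hinj (mul_right_cancel₀ (show v₁ ≠ 0 by linarith) (by linarith))
    rw [s1, s2, mul_comm] at hst
    exact absurd hst (units_ne_neg_self _)
  · exact absurd e1 hF1

/-! ### Invariants of the development -/

namespace Frame

variable (F : Frame) {c : ℕ → ℕ}

section develop

theorem orientation_develop (k : ℕ) : (F.develop c k).orientation = F.orientation := by
  induction k with
  | zero => rfl
  | succ k ih => rw [develop]; split_ifs <;> exact ih

theorem sign₁_develop (hc : c 0 = 0) (hs : ∀ k, c (k + 1) = c k ∨ c (k + 1) = c k + 1) (k : ℕ) :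
    (F.develop c k).sign₁ = F.sign₁ * (-1) ^ c k := by
  induction k with
  | zero => simp [develop, hc]
  | succ k ih =>
    rw [develop]
    split_ifs with h
    · rw [h]; exact ih
    · rw [(hs k).resolve_left h, pow_succ, ← mul_assoc, ← ih, mul_neg_one]; rfl

theorem sign₂_develop (hc : c 0 = 0) (hs : ∀ k, c (k + 1) = c k ∨ c (k + 1) = c k + 1) (k : ℕ) :
    (F.develop c k).sign₂ = F.sign₂ * (-1) ^ (k + c k) := by
  induction k with
  | zero => simp [develop, hc]
  | succ k ih =>
    rw [develop]
    split_ifs with h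
    · rw [h, add_right_comm, pow_succ, ← mul_assoc, ← ih, mul_neg_one]; rfl
    · rw [(hs k).resolve_left h, show k + 1 + (c k + 1) = k + c k + 2 by ring, pow_add,
        ← mul_assoc, ← ih, neg_one_sq, mul_one]; rfl

theorem turn_develop (k : ℕ) : (F.develop c k).turn = (((-1) ^ k : ℤ) : Fin 3) * F.turn := by
  induction k with
  | zero => simp [develop]
  | succ k ih =>
    rw [develop]
    split_ifs with h
    · rw [turn_up, ih]; push_cast; ring
    · rw [turn_right, ih]; push_cast; ring

theorem axis_develop (k : ℕ) : (F.develop c k).axis = F.axis -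
    F.turn * ((∑ m ∈ Finset.range k, if c (m + 1) = c m then 0 else (-1) ^ m : ℤ) : Fin 3) := by
  induction k with
  | zero => simp [develop]
  | succ k ih =>
    rw [develop, Finset.sum_range_succ]
    split_ifs with h
    · rw [add_zero]; exact ih
    · change (F.develop c k).axis - (F.develop c k).turn = _
      rw [ih, turn_develop]; push_cast; ring

/-- Twice the coordinate-weighted sum `∑ m, m * (centre) m` modulo `3`, for the centre of the square.
Rolling over an edge moves the centre by a vector `(±e_i ± e_k) / 2` of coordinate sum `0`, which
changes this number by `±1`. -/
def moment : Fin 3 :=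
  2 * ∑ m, (F.corner m : Fin 3) * m + (F.sign₁ : ℤ) * F.axis + (F.sign₂ : ℤ) * F.axis₂

theorem sum_single_mul (n : Fin 3 → ℤ) (d : Fin 3) (s : ℤ) :
    ∑ m, (((n + Pi.single d s : Fin 3 → ℤ) m : ℤ) : Fin 3) * m =
      ∑ m, (n m : Fin 3) * m + s * d := by
  simp only [Pi.add_apply, Int.cast_add, add_mul, Finset.sum_add_distrib]
  congr 1
  rw [Finset.sum_eq_single d]
  · simp
  · intro b _ hb; simp [Pi.single_eq_of_ne hb]
  · simp

theorem unit_cast_mul_self (s : ℤˣ) : ((s : ℤ) : Fin 3) * ((s : ℤ) : Fin 3) = 1 := by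
  rcases Int.units_eq_one_or s with rfl | rfl <;> decide

theorem three_eq_zero : (3 : Fin 3) = 0 := rfl

theorem moment_right : F.right.moment = F.moment +
    ((F.orientation : ℤ) : Fin 3) * ((F.sign₂ : ℤ) : Fin 3) := by
  unfold moment
  rw [axis₂_right]
  simp only [right, sum_single_mul]
  have h : F.turn = ((F.orientation : ℤ) : Fin 3) * ((F.sign₁ : ℤ) : Fin 3) *
      ((F.sign₂ : ℤ) : Fin 3) := by simp [turn]
  have h1 := unit_cast_mul_self F.sign₁
  have : F.axis₃ = F.axis - F.turn := rfl
  rw [this, h]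
  push_cast
  linear_combination ((F.orientation : ℤ) : Fin 3) * ((F.sign₂ : ℤ) : Fin 3) * h1

theorem moment_up : F.up.moment = F.moment -
    ((F.orientation : ℤ) : Fin 3) * ((F.sign₁ : ℤ) : Fin 3) := by
  unfold moment
  rw [axis₂_up]
  simp only [up, sum_single_mul]
  have h : F.turn = ((F.orientation : ℤ) : Fin 3) * ((F.sign₁ : ℤ) : Fin 3) *
      ((F.sign₂ : ℤ) : Fin 3) := by simp [turn]
  have h1 := unit_cast_mul_self F.sign₂
  have h3 := three_eq_zero
  have e2 : F.axis₂ = F.axis + F.turn := rfl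
  have e3 : F.axis₃ = F.axis - F.turn := rfl
  rw [e2, e3, h]
  push_cast
  linear_combination 2 * ((F.orientation : ℤ) : Fin 3) * ((F.sign₁ : ℤ) : Fin 3) * h1 +
    ((F.orientation : ℤ) : Fin 3) * ((F.sign₁ : ℤ) : Fin 3) * h3

theorem moment_develop (hc : c 0 = 0) (hs : ∀ k, c (k + 1) = c k ∨ c (k + 1) = c k + 1) (k : ℕ) :
    (F.develop c k).moment = F.moment + ((F.orientation : ℤ) : Fin 3) *
      (((F.sign₂ : ℤ) : Fin 3) *
        ((∑ m ∈ Finset.range k, if c (m + 1) = c m then 0 else (-1) ^ (m + c m) : ℤ) : Fin 3) -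
      ((F.sign₁ : ℤ) : Fin 3) *
        ((∑ m ∈ Finset.range k, if c (m + 1) = c m then (-1) ^ c m else 0 : ℤ) : Fin 3)) := by
  induction k with
  | zero => simp [develop]
  | succ k ih =>
    rw [develop, Finset.sum_range_succ, Finset.sum_range_succ]
    split_ifs with h
    · rw [moment_up, ih, orientation_develop, sign₁_develop F hc hs]
      push_cast; ring
    · rw [moment_right, ih, orientation_develop, sign₂_develop F hc hs]
      push_cast; ring

/-- If the cutting sequence has period `M`, then the development after `M` steps starts over from
the frame reached. -/
theorem develop_add {M r : ℕ} (hM : ∀ k, c (k + M) = c k + r) (k : ℕ) :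
    F.develop c (k + M) = (F.develop c M).develop c k := by
  induction k with
  | zero => simp [develop]
  | succ k ih =>
    rw [add_right_comm, develop, develop, ih]
    have : c (k + M + 1) = c (k + M) ↔ c (k + 1) = c k := by
      rw [add_right_comm, hM, hM]; omega
    simp only [this]

/-- The image of a frame under the map `x ↦ η (x shifted cyclically by d) + b` of `ℝ³`. -/
def act (d : Fin 3) (η : ℤˣ) (b : Fin 3 → ℤ) (F : Frame) : Frame where
  corner m := η * F.corner (m - d) + b m
  axis := F.axis + d
  sign₁ := η * F.sign₁
  sign₂ := η * F.sign₂
  orientation := F.orientation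

variable (d : Fin 3) (η : ℤˣ) (b : Fin 3 → ℤ)

theorem turn_act : (act d η b F).turn = F.turn := by
  have : F.orientation * (η * F.sign₁) * (η * F.sign₂) = F.orientation * F.sign₁ * F.sign₂ := by
    rw [mul_assoc, mul_mul_mul_comm, Int.units_mul_self, one_mul, mul_assoc]
  simp only [turn, act, this]

theorem act_right : act d η b F.right = (act d η b F).right := by
  refine Frame.ext ?_ ?_ ?_ rfl rfl
  · ext m
    simp only [act, right, Pi.add_apply, Pi.single_apply, Units.val_mul]
    by_cases h : m = F.axis + d
    · subst h; simp; ring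
    · rw [if_neg h, if_neg (fun h' => h (by rw [← h']; ring))]; ring
  · change F.axis - F.turn + d = F.axis + d - (act d η b F).turn
    rw [turn_act]; ring
  · simp [act, right]

theorem act_up : act d η b F.up = (act d η b F).up := by
  refine Frame.ext ?_ rfl rfl ?_ rfl
  · ext m
    have h2 : (act d η b F).axis₂ = F.axis₂ + d := by
      change F.axis + d + (act d η b F).turn = F.axis + F.turn + d
      rw [turn_act]; ring
    simp only [up, h2]
    simp only [act, Pi.add_apply, Pi.single_apply, Units.val_mul]
    by_cases h : m = F.axis₂ + d
    · subst h; simp; ring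
    · rw [if_neg h, if_neg (fun h' => h (by rw [← h']; ring))]; ring
  · simp [act, up]

theorem develop_act (k : ℕ) : (act d η b F).develop c k = act d η b (F.develop c k) := by
  induction k with
  | zero => rfl
  | succ k ih => rw [develop, develop, ih]; split_ifs <;> simp [act_right, act_up]

end develop
end Frame

/-! ### Periodic cutting sequences

The column function of a line of slope `q / p` is `k ↦ (b + k * p) / (p + q)`, with integer
division. -/

section word
variable {b p q : ℕ}

theorem word_zero (hb : b < p + q) : (b + 0 * p) / (p + q) = 0 := by
  simpa using Nat.div_eq_of_lt hb

/-- The step number `k` leads upwards exactly if the remainder is less than `q`. -/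
theorem word_succ (hN : 0 < p + q) (k : ℕ) :
    (b + (k + 1) * p) / (p + q) = (b + k * p) / (p + q) +
      if (b + k * p) % (p + q) < q then 0 else 1 := by
  have h := Nat.div_add_mod (b + k * p) (p + q)
  have hr := Nat.mod_lt (b + k * p) hN
  set r := (b + k * p) % (p + q)
  set e := (b + k * p) / (p + q)
  rw [show b + (k + 1) * p = (r + p) + (p + q) * e by rw [add_mul, ← add_assoc, ← h]; ring,
    Nat.add_mul_div_left _ _ hN, add_comm]
  congr 1
  split_ifs with h'
  · exact Nat.div_eq_of_lt (by omega)
  · exact Nat.div_eq_of_lt_le (by omega) (by omega)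

theorem word_add (hN : 0 < p + q) (m k : ℕ) :
    (b + (k + m * (p + q)) * p) / (p + q) = (b + k * p) / (p + q) + m * p := by
  rw [show b + (k + m * (p + q)) * p = (b + k * p) + (p + q) * (m * p) by ring,
    Nat.add_mul_div_left _ _ hN]

/-- Over one period, the remainder takes every value once. -/
theorem sum_word (hN : 0 < p + q) (hpq : p.Coprime q) (f : ℕ → ℤ) :
    ∑ k ∈ Finset.range (p + q), f ((b + k * p) % (p + q)) = ∑ r ∈ Finset.range (p + q), f r := by
  have hinj : Set.InjOn (fun k => (b + k * p) % (p + q)) (Finset.range (p + q)) := by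
    intro k hk l hl h
    have h1 : b + k * p ≡ b + l * p [MOD p + q] := h
    have h2 := Nat.ModEq.add_left_cancel' b h1
    have h3 : k ≡ l [MOD p + q] := Nat.ModEq.cancel_right_of_coprime (by simpa using hpq.symm) h2
    simp only [Finset.coe_range, Set.mem_Iio] at hk hl
    exact Nat.ModEq.eq_of_lt_of_lt h3 hk hl
  have himg : (Finset.range (p + q)).image (fun k => (b + k * p) % (p + q)) =
      Finset.range (p + q) := by
    apply Finset.eq_of_subset_of_card_le
    · intro r hr
      obtain ⟨k, -, rfl⟩ := Finset.mem_image.1 hr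
      exact Finset.mem_range.2 (Nat.mod_lt _ hN)
    · rw [Finset.card_image_of_injOn hinj]
  conv_rhs => rw [← himg, Finset.sum_image hinj]

theorem sum_alternating_lt (hq : Odd q) :
    ∑ r ∈ Finset.range (p + q), (if r < q then (-1) ^ r else 0 : ℤ) = 1 := by
  rw [← Finset.sum_filter, show (Finset.range (p + q)).filter (· < q) = Finset.range q by
    ext; simp; omega, neg_one_geom_sum, if_neg (Nat.not_even_iff_odd.2 hq)]

theorem sum_alternating_ge (hp : Odd p) :
    ∑ r ∈ Finset.range (p + q), (if r < q then 0 else (-1) ^ r : ℤ) = (-1) ^ q := by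
  have h : ∀ r, (if r < q then 0 else (-1) ^ r : ℤ) = (-1) ^ r - if r < q then (-1) ^ r else 0 := by
    intro r; split_ifs <;> simp
  simp only [h]
  rw [Finset.sum_sub_distrib, ← Finset.sum_filter,
    show (Finset.range (p + q)).filter (· < q) = Finset.range q by ext; simp; omega,
    neg_one_geom_sum, neg_one_geom_sum]
  rcases Nat.even_or_odd q with hq | hq
  · rw [if_neg (by simp [Nat.even_add, hq, hp]), if_pos hq, hq.neg_one_pow]; norm_num
  · rw [if_pos (hp.add_odd hq),
      if_neg (Nat.not_even_iff_odd.2 hq), hq.neg_one_pow]; norm_num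

theorem neg_one_pow_congr {m n : ℕ} (h : m % 2 = n % 2) : (-1 : ℤ) ^ m = (-1) ^ n := by
  rw [neg_one_pow_eq_pow_mod_two, h, ← neg_one_pow_eq_pow_mod_two]

theorem word_succ_eq_iff (hN : 0 < p + q) (k : ℕ) :
    (b + (k + 1) * p) / (p + q) = (b + k * p) / (p + q) ↔ (b + k * p) % (p + q) < q := by
  rw [word_succ hN]; split_ifs with h <;> simp [h]

theorem sum_range_double {M : Type*} [AddCommMonoid M] (f : ℕ → M) (n : ℕ) :
    ∑ k ∈ Finset.range (2 * n), f k = ∑ k ∈ Finset.range n, (f k + f (k + n)) := by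
  rw [two_mul, Finset.sum_range_add, Finset.sum_add_distrib]
  simp only [add_comm n]

/-- Division with remainder modulo `2`: it expresses signs through the remainder. -/
theorem word_parity (k : ℕ) :
    ((p + q) % 2 * ((b + k * p) / (p + q)) + (b + k * p) % (p + q)) % 2 =
      (b + k * (p % 2)) % 2 := by
  have h1 : (p + q) % 2 * ((b + k * p) / (p + q)) + (b + k * p) % (p + q) ≡ b + k * p [MOD 2] := by
    conv_rhs => rw [← Nat.div_add_mod (b + k * p) (p + q)]
    exact ((Nat.mod_modEq _ _).mul_right _).add_right _
  exact h1.trans (((Nat.mod_modEq p 2).mul_left k).add_left b).symm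

/-- A sign that depends on the remainder alone is summed over a period by reordering. -/
theorem sum_word_sign (hN : 0 < p + q) (hpq : p.Coprime q) {u w : ℤ} (e : ℕ → ℕ)
    (he : ∀ k, e k % 2 = (b + (b + k * p) % (p + q)) % 2) :
    ∑ k ∈ Finset.range (p + q), (if (b + k * p) % (p + q) < q then u * (-1) ^ e k
      else w * (-1) ^ e k) =
    (-1) ^ b * ∑ r ∈ Finset.range (p + q), (if r < q then u * (-1) ^ r else w * (-1) ^ r) := by
  rw [← sum_word (b := b) hN hpq fun r => if r < q then u * (-1) ^ r else w * (-1) ^ r,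
    Finset.mul_sum]
  refine Finset.sum_congr rfl fun k _ => ?_
  rw [neg_one_pow_congr (he k), pow_add]
  split_ifs <;> ring

/-- Up to the factor `-turn`, the total change of the first axis over a period, if `p` and `q` are
odd. -/
theorem sum_word_odd_odd (hpq : p.Coprime q) (hp : Odd p) (hq : Odd q) :
    ∑ m ∈ Finset.range (p + q), (if (b + (m + 1) * p) / (p + q) = (b + m * p) / (p + q) then 0
      else (-1) ^ m : ℤ) = (-1) ^ (b + 1) := by
  have hN : 0 < p + q := by have := hp.pos; omega
  simp only [word_succ_eq_iff hN]
  have := sum_word_sign (b := b) hN hpq (u := 0) (w := 1) (fun m => m) fun k => by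
    have h := word_parity (b := b) (p := p) (q := q) k
    have h2 : (p + q) % 2 = 0 := Nat.even_iff.1 (hp.add_odd hq)
    rw [h2, Nat.odd_iff.1 hp] at h
    omega
  simp only [zero_mul, one_mul] at this
  rw [this, sum_alternating_ge hp, hq.neg_one_pow, pow_succ]

/-- If `p + q` is odd, then the changes of the first axis in two consecutive periods cancel. -/
theorem sum_word_index (hN : Odd (p + q)) :
    ∑ m ∈ Finset.range (2 * (p + q)), (if (b + (m + 1) * p) / (p + q) = (b + m * p) / (p + q) then 0
      else (-1) ^ m : ℤ) = 0 := by
  simp only [word_succ_eq_iff hN.pos]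
  rw [sum_range_double]
  refine Finset.sum_eq_zero fun k _ => ?_
  rw [show b + (k + (p + q)) * p = b + k * p + (p + q) * p by ring, Nat.add_mul_mod_self_left,
    pow_add, hN.neg_one_pow]
  split_ifs <;> ring

/-- The contribution of the steps to the right to the change of the moment over two periods. For
even `p` the two periods cancel, for odd `p` they contribute equally. -/
theorem sum_word_right (hN : Odd (p + q)) (hpq : p.Coprime q) :
    ∑ m ∈ Finset.range (2 * (p + q)), (if (b + (m + 1) * p) / (p + q) = (b + m * p) / (p + q) then 0
      else (-1) ^ (m + (b + m * p) / (p + q)) : ℤ) =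
      if Odd p then 2 * (-1) ^ b else 0 := by
  simp only [word_succ_eq_iff hN.pos]
  rw [sum_range_double]
  have hshift : ∀ k, (b + (k + (p + q)) * p) / (p + q) = (b + k * p) / (p + q) + p := fun k => by
    simpa using word_add hN.pos 1 k
  simp only [hshift]
  simp only [show ∀ k, b + (k + (p + q)) * p = b + k * p + (p + q) * p by intro k; ring,
    Nat.add_mul_mod_self_left]
  split_ifs with hp
  · have hq : Even q := by
      by_contra h
      exact absurd hN (Nat.not_odd_iff_even.2 (hp.add_odd (Nat.not_even_iff_odd.1 h)))
    have := sum_word_sign (b := b) hN.pos hpq (u := 0) (w := 1)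
      (fun m => m + (b + m * p) / (p + q)) fun k => by
        have h := word_parity (b := b) (p := p) (q := q) k
        rw [Nat.odd_iff.1 hN, Nat.odd_iff.1 hp] at h
        omega
    simp only [zero_mul, one_mul] at this
    rw [sum_alternating_ge hp, hq.neg_one_pow, mul_one] at this
    rw [← this, Finset.mul_sum]
    refine Finset.sum_congr rfl fun k _ => ?_
    split_ifs
    · simp
    · rw [show k + (p + q) + ((b + k * p) / (p + q) + p) =
        k + (b + k * p) / (p + q) + ((p + q) + p) by ring, pow_add _ (k + _),
        Even.neg_one_pow (hN.add_odd hp)]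
      ring
  · refine Finset.sum_eq_zero fun k _ => ?_
    split_ifs
    · simp
    · rw [show k + (p + q) + ((b + k * p) / (p + q) + p) =
        k + (b + k * p) / (p + q) + ((p + q) + p) by ring, pow_add _ (k + _),
        Odd.neg_one_pow (hN.add_even (Nat.not_odd_iff_even.1 hp))]
      ring

/-- The contribution of the steps upwards to the change of the moment over two periods. For odd `p`
the two periods cancel, for even `p` they contribute equally. -/
theorem sum_word_up (hN : Odd (p + q)) (hpq : p.Coprime q) :
    ∑ m ∈ Finset.range (2 * (p + q)), (if (b + (m + 1) * p) / (p + q) = (b + m * p) / (p + q)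
      then (-1) ^ ((b + m * p) / (p + q)) else 0 : ℤ) =
      if Odd p then 0 else 2 * (-1) ^ b := by
  simp only [word_succ_eq_iff hN.pos]
  rw [sum_range_double]
  have hshift : ∀ k, (b + (k + (p + q)) * p) / (p + q) = (b + k * p) / (p + q) + p := fun k => by
    simpa using word_add hN.pos 1 k
  simp only [hshift]
  simp only [show ∀ k, b + (k + (p + q)) * p = b + k * p + (p + q) * p by intro k; ring,
    Nat.add_mul_mod_self_left]
  split_ifs with hp
  · refine Finset.sum_eq_zero fun k _ => ?_
    rw [pow_add, hp.neg_one_pow]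
    split_ifs <;> ring
  · have hp : Even p := Nat.not_odd_iff_even.1 hp
    have hq : Odd q := by
      by_contra h
      exact absurd hN (Nat.not_odd_iff_even.2 (hp.add (Nat.not_odd_iff_even.1 h)))
    have := sum_word_sign (b := b) hN.pos hpq (u := 1) (w := 0)
      (fun m => (b + m * p) / (p + q)) fun k => by
        have h := word_parity (b := b) (p := p) (q := q) k
        rw [Nat.odd_iff.1 hN, Nat.even_iff.1 hp] at h
        omega
    simp only [zero_mul, one_mul] at this
    rw [sum_alternating_lt hq, mul_one] at this
    rw [← this, Finset.mul_sum]
    refine Finset.sum_congr rfl fun k _ => ?_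
    rw [pow_add, hp.neg_one_pow]
    split_ifs <;> ring

end word

/-- A line of rational slope has a periodic column function. -/
theorem column_eq {x y l : ℝ} {p q : ℕ} (hl : 0 < l) (hx : 0 ≤ x) (hy : y ≤ 1) (k : ℕ) :
    column x y (l * p) (l * q) k = (⌊q * x + p * (1 - y)⌋₊ + k * p) / (p + q) := by
  have h0 : 0 ≤ q * x + p * (1 - y) := by
    have := sub_nonneg.2 hy
    positivity
  have h1 : (l * q * x + l * p * (1 - y) + k * (l * p)) / (l * p + l * q) =
      (q * x + p * (1 - y) + ((k * p : ℕ) : ℝ)) / ((p + q : ℕ) : ℝ) := by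
    rw [← mul_add, show l * q * x + l * p * (1 - y) + k * (l * p) =
      l * (q * x + p * (1 - y) + k * p) by ring, mul_div_mul_left _ _ hl.ne']
    push_cast; rfl
  rw [column, h1, Nat.floor_div_natCast, Nat.floor_add_natCast h0]

theorem column_offset_lt {x y : ℝ} {p q : ℕ} (hx : 0 < x) (hx' : x < 1) (hy : 0 < y) (hy' : y < 1)
    (hN : 0 < p + q) : ⌊q * x + p * (1 - y)⌋₊ < p + q := by
  have h0 : 0 ≤ q * x + p * (1 - y) := by
    have := sub_pos.2 hy'
    positivity
  rw [Nat.floor_lt h0]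
  push_cast
  rcases Nat.eq_zero_or_pos p with rfl | hp
  · have : (0 : ℝ) < q := by exact_mod_cast (by omega : 0 < q)
    push_cast
    nlinarith
  · have : (0 : ℝ) < p := by exact_mod_cast hp
    have h1 : (q : ℝ) * x ≤ q := mul_le_of_le_one_right q.cast_nonneg hx'.le
    nlinarith

/-! ### Rotoreflections of order six -/

variable {γ : ℝ → surface}

/-- The isometry `x ↦ -(x shifted cyclically by d) + b` of `ℝ³`. -/
def rotoreflection (d : Fin 3) (b : Fin 3 → ℤ) : E3 ≃ᵢ E3 :=
  ((LinearIsometryEquiv.piLpCongrLeft 2 ℝ ℝ (Equiv.addRight d)).trans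
    (LinearIsometryEquiv.neg ℝ)).toIsometryEquiv.trans
    (IsometryEquiv.addRight (WithLp.toLp 2 fun m => (b m : ℝ)))

variable (d : Fin 3) (b : Fin 3 → ℤ)

theorem rotoreflection_apply (x : E3) (m : Fin 3) :
    rotoreflection d b x m = -x (m - d) + b m := by
  simp [rotoreflection, LinearIsometryEquiv.piLpCongrLeft_apply, sub_eq_add_neg]

theorem rotoreflection_pos (F : Frame) (x y : ℝ) :
    rotoreflection d b (F.pos x y) = (F.act d (-1) b).pos x y := by
  ext m
  have h2 : (F.act d (-1) b).axis₂ = F.axis₂ + d := by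
    change F.axis + d + (Frame.act d (-1) b F).turn = F.axis + F.turn + d
    rw [Frame.turn_act]; ring
  rw [rotoreflection_apply]
  simp only [Frame.pos, h2]
  simp only [Frame.act, ← sub_eq_iff_eq_add]
  split_ifs <;> push_cast <;> ring

theorem rotoreflection_pow_two (x : E3) (m : Fin 3) :
    (rotoreflection d b ^ 2) x m = x (m - d - d) + (b m - b (m - d)) := by
  change rotoreflection d b (rotoreflection d b x) m = _
  simp only [rotoreflection_apply]; ring

theorem rotoreflection_pow_three (x : E3) (m : Fin 3) :
    (rotoreflection d b ^ 3) x m = -x m + (b m - b (m - d) + b (m - d - d)) := by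
  change rotoreflection d b (rotoreflection d b (rotoreflection d b x)) m = _
  have : m - d - d - d = m := by revert m d; decide
  simp only [rotoreflection_apply, this]; ring

theorem orderOf_rotoreflection (hd : d ≠ 0) : orderOf (rotoreflection d b) = 6 := by
  refine orderOf_eq_of_pow_and_pow_div_prime (by norm_num) ?_ fun p hp hp6 => ?_
  · rw [show 6 = 3 + 3 by rfl, pow_add]
    ext x m
    change (rotoreflection d b ^ 3) ((rotoreflection d b ^ 3) x) m = x m
    simp only [rotoreflection_pow_three]; ring
  · have : p = 2 ∨ p = 3 := by
      have := (Nat.Prime.dvd_mul hp).1 (show p ∣ 2 * 3 from hp6)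
      rwa [Nat.prime_dvd_prime_iff_eq hp Nat.prime_two,
        Nat.prime_dvd_prime_iff_eq hp Nat.prime_three] at this
    rcases this with rfl | rfl <;> intro h
    · have h0 := congrArg (fun f : E3 ≃ᵢ E3 => f 0 0) h
      have h1 := congrArg (fun f : E3 ≃ᵢ E3 => f (EuclideanSpace.single 0 1) 0) h
      norm_num [rotoreflection_pow_three, IsometryEquiv.coe_one] at h0 h1
      linarith
    · have hne : 0 - d - d ≠ 0 := by clear h; revert d; decide
      have h0 := congrArg (fun f : E3 ≃ᵢ E3 => f 0 0) h
      have h1 := congrArg (fun f : E3 ≃ᵢ E3 => f (EuclideanSpace.single 0 1) 0) h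
      simp only [Nat.reduceDiv, rotoreflection_pow_two, IsometryEquiv.coe_one, id,
        PiLp.zero_apply, PiLp.single_apply, if_neg hne] at h0 h1
      norm_num at h0 h1
      linarith

variable {d b}

theorem rotoreflection_mem_vertices (hb : ∑ m, b m = 0) {z : E3} (hz : z ∈ vertices) :
    rotoreflection d b z ∈ vertices := by
  obtain ⟨n, hn, h1, h2⟩ := mem_vertices_iff.1 hz
  have hs : ∑ m, (-n (m - d) + b m) = -∑ m, n m := by
    rw [Finset.sum_add_distrib, hb, add_zero, Finset.sum_neg_distrib]
    congr 1
    exact Equiv.sum_comp (Equiv.subRight d) n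
  refine mem_vertices_iff.2 ⟨fun m => -n (m - d) + b m, fun m => ?_, ?_, ?_⟩
  · rw [rotoreflection_apply, hn]; push_cast; rfl
  · rw [hs]; omega
  · rw [hs]; omega

theorem rotoreflection_mem_surface (hb : ∑ m, b m = 0) {z : E3} (hz : z ∈ surface) :
    rotoreflection d b z ∈ surface := by
  obtain ⟨a, u, w, h, s, hs, t, ht, rfl⟩ := hz
  set L : E3 ≃ₗᵢ[ℝ] E3 := (LinearIsometryEquiv.piLpCongrLeft 2 ℝ ℝ (Equiv.addRight d)).trans
    (LinearIsometryEquiv.neg ℝ)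
  have hL : ∀ y z, rotoreflection d b (y + z) = rotoreflection d b y + L z := fun y z => by
    change L (y + z) + _ = L y + _ + L z
    rw [map_add]; abel
  refine ⟨rotoreflection d b a, L u, L w, ⟨?_, ?_, ?_, ?_, ?_, ?_, ?_⟩, s, hs, t, ht, ?_⟩
  · rw [L.norm_map, h.norm_left]
  · rw [L.norm_map, h.norm_right]
  · rw [L.inner_map_map, h.orthogonal]
  · exact rotoreflection_mem_vertices hb h.corner_mem
  · rw [← hL]; exact rotoreflection_mem_vertices hb h.corner_left_mem
  · rw [← hL]; exact rotoreflection_mem_vertices hb h.corner_right_mem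
  · rw [← hL, ← hL]; exact rotoreflection_mem_vertices hb h.corner_opposite_mem
  · rw [hL, hL, map_smul, map_smul]

/-- The inclusion of the surface in its image uses that the inverse is the fifth power. -/
theorem rotoreflection_image_surface (hd : d ≠ 0) (hb : ∑ m, b m = 0) :
    rotoreflection d b '' surface = surface := by
  refine Set.Subset.antisymm ?_ fun z hz => ?_
  · rintro _ ⟨z, hz, rfl⟩
    exact rotoreflection_mem_surface hb hz
  · have hpow : ∀ n : ℕ, (rotoreflection d b ^ n) z ∈ surface := fun n => by
      induction n with
      | zero => exact hz
      | succ n ih => rw [pow_succ']; exact rotoreflection_mem_surface hb ih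
    refine ⟨_, hpow 5, ?_⟩
    have h6 : rotoreflection d b ^ 6 = 1 := by
      rw [← orderOf_rotoreflection d b hd]; exact pow_orderOf_eq_one _
    change (rotoreflection d b * rotoreflection d b ^ 5) z = z
    rw [← pow_succ', h6]; rfl

/-! ### The holonomy of a period -/

/-- If `p + q` is odd, then two periods of the cutting sequence translate the frame, and the
translation is not trivial because it changes the moment. So no multiple of the period leads back
to the first frame. -/
theorem Frame.develop_ne_self_of_odd {F : Frame} {c : ℕ → ℕ} {b p q m : ℕ} (hm : 0 < m)
    (hb : b < p + q) (hpq : p.Coprime q) (hodd : Odd (p + q))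
    (hc : ∀ k, c k = (b + k * p) / (p + q)) : F.develop c (m * (p + q)) ≠ F := by
  intro hper
  have hN := hodd.pos
  have hc0 : c 0 = 0 := by rw [hc]; exact word_zero hb
  have hs : ∀ k, c (k + 1) = c k ∨ c (k + 1) = c k + 1 := fun k => by
    rw [hc, hc, word_succ hN]; split_ifs <;> simp
  have hshift : ∀ n k, c (k + n * (p + q)) = c k + n * p := fun n k => by
    rw [hc, hc, word_add hN]
  set T : Fin 3 → ℤ := fun k => (F.develop c (2 * (p + q))).corner k - F.corner k with hT
  have hc2 : c (2 * (p + q)) = 2 * p := by simpa [hc0] using hshift 2 0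
  have hact : F.develop c (2 * (p + q)) = F.act 0 1 T := by
    refine Frame.ext ?_ ?_ ?_ ?_ ?_
    · ext k; simp [Frame.act, hT]
    · rw [axis_develop]
      simp only [hc]
      rw [sum_word_index hodd]
      simp [act]
    · rw [sign₁_develop F hc0 hs, hc2, pow_mul]; simp [act]
    · rw [sign₂_develop F hc0 hs, hc2, ← mul_add, pow_mul]; simp [act]
    · rw [orientation_develop]; rfl
  have hcorner : ∀ n i, (F.develop c (n * (2 * (p + q)))).corner i = F.corner i + n * T i := by
    intro n i
    induction n with
    | zero => simp [Frame.develop]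
    | succ n ih =>
      rw [add_mul, one_mul, F.develop_add (hshift 2), hact, develop_act]
      simp only [Frame.act, sub_zero, Units.val_one, one_mul, ih]
      push_cast; ring
  -- `m` periods lead back to the first frame, hence so do `2 m` periods, which translate by `m T`
  have hTzero : ∀ i, T i = 0 := fun i => by
    have h1 := hcorner m i
    rw [show m * (2 * (p + q)) = m * (p + q) + m * (p + q) by ring, F.develop_add (hshift m),
      hper, hper] at h1
    have : (m : ℤ) * T i = 0 := by linarith
    exact (mul_eq_zero.1 this).resolve_left (by exact_mod_cast hm.ne')
  have hback : F.develop c (2 * (p + q)) = F := by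
    rw [hact]
    refine Frame.ext ?_ ?_ ?_ ?_ rfl
    · ext i; simp [act, hTzero i]
    all_goals simp [act]
  have hmom := F.moment_develop hc0 hs (2 * (p + q))
  rw [hback] at hmom
  simp only [hc] at hmom
  rw [sum_word_right hodd hpq, sum_word_up hodd hpq] at hmom
  have hunit : ∀ u : ℤˣ, ((u : ℤ) : Fin 3) = 1 ∨ ((u : ℤ) : Fin 3) = -1 := fun u => by
    rcases Int.units_eq_one_or u with rfl | rfl <;> simp
  have hpow : (((-1) ^ b : ℤ) : Fin 3) = 1 ∨ (((-1) ^ b : ℤ) : Fin 3) = -1 := by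
    rcases neg_one_pow_eq_or ℤ b with h | h <;> simp [h]
  rw [left_eq_add] at hmom
  -- one of the two sums vanishes and the other is `±2`, which is not divisible by `3`
  have key : ∀ o s t e : Fin 3, (o = 1 ∨ o = -1) → (s = 1 ∨ s = -1) → (t = 1 ∨ t = -1) →
      (e = 1 ∨ e = -1) → o * (t * (2 * e) - s * 0) ≠ 0 ∧ o * (t * 0 - s * (2 * e)) ≠ 0 := by decide
  have := key _ _ _ _ (hunit F.orientation) (hunit F.sign₁) (hunit F.sign₂) hpow
  split_ifs at hmom with h
  · exact this.1 (by simpa using hmom)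
  · exact this.2 (by simpa using hmom)

/-- If `p` and `q` are odd, then a period of the cutting sequence acts on all frames as a
rotoreflection of order six, and only multiples of six periods lead back to the first frame: the
sign requires an even number, and the axis a multiple of three. -/
theorem Frame.OnSurface.exists_rotoreflection {F : Frame} (hF : F.OnSurface) {c : ℕ → ℕ}
    {b p q : ℕ} (hb : b < p + q) (hpq : p.Coprime q) (hp : Odd p) (hq : Odd q)
    (hc : ∀ k, c k = (b + k * p) / (p + q)) :
    ∃ (d : Fin 3) (n : Fin 3 → ℤ), d ≠ 0 ∧ ∑ m, n m = 0 ∧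
      (∀ k, F.develop c (k + (p + q)) = (F.develop c k).act d (-1) n) ∧
      ∀ m, F.develop c (m * (p + q)) = F → 6 ∣ m := by
  have hN : 0 < p + q := by have := hp.pos; omega
  have hc0 : c 0 = 0 := by rw [hc]; exact word_zero hb
  have hs : ∀ k, c (k + 1) = c k ∨ c (k + 1) = c k + 1 := fun k => by
    rw [hc, hc, word_succ hN]; split_ifs <;> simp
  have hshift : ∀ n k, c (k + n * (p + q)) = c k + n * p := fun n k => by
    rw [hc, hc, word_add hN]
  have hshift1 : ∀ k, c (k + (p + q)) = c k + p := fun k => by simpa using hshift 1 k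
  have hcN : c (p + q) = p := by simpa [hc0] using hshift1 0
  set G := F.develop c (p + q) with hG
  have hGS : G.OnSurface := hF.develop c _
  set d := G.axis - F.axis with hd
  -- the translation part is chosen so that the first frame is mapped to the frame after one period
  set n : Fin 3 → ℤ := fun m => G.corner m + F.corner (m - d) with hn
  have hs1 : G.sign₁ = -F.sign₁ := by
    rw [hG, F.sign₁_develop hc0 hs, hcN, hp.neg_one_pow, mul_neg_one]
  have hs2 : G.sign₂ = -F.sign₂ := by
    rw [hG, F.sign₂_develop hc0 hs, hcN, ((hp.add_odd hq).add_odd hp).neg_one_pow, mul_neg_one]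
  have hact : G = F.act d (-1) n := by
    refine Frame.ext ?_ ?_ ?_ ?_ ?_
    · ext k; simp [Frame.act, hn]
    · simp [Frame.act, hd]
    · simp [Frame.act, hs1]
    · simp [Frame.act, hs2]
    · exact F.orientation_develop _
  have hstep : ∀ k, F.develop c (k + (p + q)) = (F.develop c k).act d (-1) n := fun k => by
    rw [F.develop_add hshift1, ← hG, hact, Frame.develop_act]
  have hd0 : d ≠ 0 := by
    have h1 : d = -(F.turn * (((-1) ^ (b + 1) : ℤ) : Fin 3)) := by
      rw [hd, hG, F.axis_develop]
      simp only [hc]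
      rw [sum_word_odd_odd hpq hp hq]; ring
    rw [h1]
    rcases neg_one_pow_eq_or ℤ (b + 1) with h | h <;> simp [h, F.turn_ne_zero]
  refine ⟨d, n, hd0, ?_, hstep, fun m hm => ?_⟩
  · have h1 : ∑ m, F.corner (m - d) = ∑ m, F.corner m := Equiv.sum_comp (Equiv.subRight d) F.corner
    simp only [hn, Finset.sum_add_distrib, h1]
    unfold Frame.OnSurface at hF hGS
    rw [hs1, hs2] at hGS
    push_cast at hGS
    omega
  · -- the sign of the first side is reversed in each period
    have h2 : 2 ∣ m := by
      have h1 := F.sign₁_develop hc0 hs (m * (p + q))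
      have h3 : c (m * (p + q)) = m * p := by simpa [hc0] using hshift m 0
      rw [hm, h3, left_eq_mul] at h1
      by_contra h
      rw [← even_iff_two_dvd, Nat.not_even_iff_odd] at h
      rw [(h.mul hp).neg_one_pow] at h1
      exact absurd h1 (by decide)
    have haxis : ∀ k : ℕ, (F.develop c (k * (p + q))).axis = F.axis + k * d := fun k => by
      induction k with
      | zero => simp [Frame.develop]
      | succ k ih =>
        rw [add_mul, one_mul, hstep]
        simp only [Frame.act, ih]
        push_cast; ring
    have h3 : 3 ∣ m := by
      have h1 := haxis m
      rw [hm, left_eq_add] at h1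
      have hmul : ∀ e d : Fin 3, d ≠ 0 → e * d = 0 → e = 0 := by decide
      exact (Fin.natCast_eq_zero).1 (hmul _ d hd0 h1)
    omega

/-! ### The symmetry of a periodic geodesic -/

theorem IsGeodesic.comp_add (hγ : IsGeodesic γ) (t₀ : ℝ) : IsGeodesic fun t => γ (t₀ + t) := by
  intro t
  obtain ⟨a, u, u', w, h, p, v, hv, ε, hε, H⟩ := hγ (t₀ + t)
  refine ⟨a, u, u', w, h, p, v, hv, ε, hε, fun s hs => ?_⟩
  have := H (t₀ + s) ⟨by linarith [hs.1], by linarith [hs.2]⟩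
  rwa [add_sub_add_left_eq_sub] at this

theorem eq_of_periodic_of_nonneg {X : Type*} {f g : ℝ → X} {ℓ : ℝ} (hℓ : 0 < ℓ)
    (hf : Function.Periodic f ℓ) (hg : Function.Periodic g ℓ) (h : ∀ t ≥ 0, f t = g t) (t : ℝ) :
    f t = g t := by
  obtain ⟨n, hn⟩ := exists_nat_ge (-t / ℓ)
  rw [div_le_iff₀ hℓ] at hn
  rw [← hf.nat_mul n t, ← hg.nat_mul n t]
  exact h _ (by linarith)

/-- The theorem for a geodesic that at time `0` is inside a square, with nonnegative velocity in
the frame of this square. -/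
theorem IsGeodesic.exists_symmetry (hγ : IsGeodesic γ) {ℓ : ℝ} (hℓ : IsLeastPeriod γ ℓ)
    {F : Frame} (hF : F.OnSurface) {x y v₁ v₂ : ℝ} (hx : 0 < x) (hx' : x < 1) (hy : 0 < y)
    (hy' : y < 1) (hv₁ : 0 ≤ v₁) (hv₂ : 0 ≤ v₂) (hv : 0 < v₁ + v₂)
    (h : ∀ᶠ s in 𝓝 0, (γ s : E3) = F.pos (x + s * v₁) (y + s * v₂)) :
    ∃ ξ : E3 ≃ᵢ E3, orderOf ξ = 6 ∧ ξ '' surface = surface ∧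
      ∀ t : ℝ, ξ (γ t) = γ (t + ℓ / 6) := by
  obtain ⟨hℓ0, hper⟩ := hℓ.1
  have htrack := hγ.eq_develop hF hx hx' hy hy' hv₁ hv₂ hv h
  -- comparing the motions shortly after the times `0` and `ℓ` shows that the frames agree
  obtain ⟨i, j, hi, hj, hFij⟩ : ∃ i j : ℕ, ℓ * v₁ = i ∧ ℓ * v₂ = j ∧
      F.develop (column x y v₁ v₂) (i + j) = F := by
    have hX : 0 ≤ x + ℓ * v₁ := by positivity
    have hY : 0 ≤ y + ℓ * v₂ := by positivity
    have h1 := Nat.floor_le hX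
    have h2 := Nat.lt_floor_add_one (x + ℓ * v₁)
    have h3 := Nat.floor_le hY
    have h4 := Nat.lt_floor_add_one (y + ℓ * v₂)
    have hℓe := htrack ℓ hℓ0.le
    have hright : ContinuousAt (fun s => ℓ + s) 0 := by fun_prop
    have hten : Tendsto (fun s => ℓ + s) (𝓝[>] 0) (𝓝[≥] ℓ) := by
      refine tendsto_nhdsWithin_of_tendsto_nhds_of_eventually_within _ ?_ ?_
      · have := hright.tendsto
        rw [add_zero] at this
        exact this.mono_left nhdsWithin_le_nhds
      · filter_upwards [self_mem_nhdsWithin] with s hs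
        have : 0 < s := hs
        exact (by simpa using this.le : ℓ ≤ ℓ + s)
    obtain ⟨τ, ⟨k1, k2⟩, k3, k4⟩ := ((hten.eventually
      ((eventually_floor_eq_right hv₁ h1 h2).and (eventually_floor_eq_right hv₂ h3 h4))).and
      ((h.filter_mono nhdsWithin_le_nhds).and self_mem_nhdsWithin)).exists
    have k4 : 0 < τ := k4
    have hτ := htrack (ℓ + τ) (by positivity)
    rw [k1, k2] at hτ
    have p0 : γ ℓ = γ 0 := by simpa using hper 0
    have p1 : γ (ℓ + τ) = γ τ := by rw [add_comm]; exact hper τ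
    have h0 := h.self_of_nhds
    simp only [zero_mul, add_zero] at h0
    rw [p0, h0] at hℓe
    rw [p1, k3] at hτ
    obtain ⟨e1, e2, e3⟩ := Frame.eq_of_germ (F.orientation_develop _).symm hx hx' hy hy'
      (sub_nonneg.2 h1) (by linarith) (sub_nonneg.2 h3) (by linarith) hv₁ hv₂ hv k4.ne' hℓe
      (hτ.trans (by congr 1 <;> ring))
    exact ⟨_, _, by linarith, by linarith, e1.symm⟩
  -- reduce the direction to lowest terms
  have hij : 0 < i + j := by
    have : (0 : ℝ) < ((i + j : ℕ) : ℝ) := by push_cast; rw [← hi, ← hj, ← mul_add]; positivity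
    exact_mod_cast this
  have hm : 0 < Nat.gcd i j := Nat.pos_of_ne_zero fun h0 => by
    rw [Nat.gcd_eq_zero_iff] at h0; omega
  obtain ⟨p, q, hpq, hip, hjq⟩ := Nat.exists_coprime i j
  set m := Nat.gcd i j with hmdef
  have hmR : (0 : ℝ) < m := by exact_mod_cast hm
  set l : ℝ := m / ℓ with hl
  have hl0 : 0 < l := div_pos hmR hℓ0
  have hv₁' : v₁ = l * p := by
    rw [hip] at hi; push_cast at hi
    rw [hl, div_mul_eq_mul_div, eq_div_iff hℓ0.ne']; linarith
  have hv₂' : v₂ = l * q := by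
    rw [hjq] at hj; push_cast at hj
    rw [hl, div_mul_eq_mul_div, eq_div_iff hℓ0.ne']; linarith
  have hN : 0 < p + q := by
    rcases Nat.eq_zero_or_pos (p + q) with h0 | h0
    · rw [hip, hjq, ← add_mul, h0, zero_mul] at hij; omega
    · exact h0
  set b := ⌊q * x + p * (1 - y)⌋₊ with hb
  have hbN : b < p + q := column_offset_lt hx hx' hy hy' hN
  set c := column x y v₁ v₂ with hcdef
  have hc : ∀ k, c k = (b + k * p) / (p + q) := fun k => by
    rw [hcdef, hv₁', hv₂', column_eq hl0 hx.le hy'.le]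
  rw [show i + j = m * (p + q) by rw [mul_comm, add_mul, ← hip, ← hjq]] at hFij
  rcases Nat.even_or_odd (p + q) with hpar | hpar
  swap
  · exact absurd hFij (Frame.develop_ne_self_of_odd hm hbN hpq hpar hc)
  have hp : Odd p := by
    by_contra hp
    rw [Nat.not_odd_iff_even] at hp
    have hq : Even q := (Nat.even_add.1 hpar).1 hp
    exact Nat.not_coprime_of_dvd_of_dvd one_lt_two hp.two_dvd hq.two_dvd hpq
  have hq : Odd q := by
    by_contra hq
    rw [Nat.not_odd_iff_even] at hq
    exact Nat.not_even_iff_odd.2 hp ((Nat.even_add.1 hpar).2 hq)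
  obtain ⟨d, n, hd, hn, hstep, hsix⟩ := hF.exists_rotoreflection hbN hpq hp hq hc
  set ξ := rotoreflection d n
  set τ := ℓ / m with hτ
  have hτ0 : 0 < τ := div_pos hℓ0 hmR
  have hτl : τ * l = 1 := by rw [hτ, hl]; field_simp
  have hsym : ∀ t, ξ (γ t) = γ (t + τ) := by
    refine eq_of_periodic_of_nonneg hℓ0 (fun t => by rw [hper])
      (fun t => by rw [add_right_comm, hper]) fun t ht => ?_
    have hX : 0 ≤ x + t * v₁ := by positivity
    have hY : 0 ≤ y + t * v₂ := by positivity
    have e1 : x + (t + τ) * v₁ = x + t * v₁ + p := by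
      rw [add_mul, hv₁', ← mul_assoc τ, hτl]; ring
    have e2 : y + (t + τ) * v₂ = y + t * v₂ + q := by
      rw [add_mul, hv₂', ← mul_assoc τ, hτl]; ring
    rw [htrack t ht, htrack (t + τ) (by positivity), rotoreflection_pos, e1, e2,
      Nat.floor_add_natCast hX, Nat.floor_add_natCast hY, add_add_add_comm, hstep]
    congr 1 <;> push_cast <;> ring
  have hξ := orderOf_rotoreflection d n hd
  refine ⟨ξ, hξ, rotoreflection_image_surface hd hn, ?_⟩
  have hpow : ∀ (k : ℕ) t, (ξ ^ k) (γ t) = γ (t + k * τ) := fun k => by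
    induction k with
    | zero => intro t; simp [IsometryEquiv.coe_one]
    | succ k ih =>
      intro t
      rw [pow_succ']
      change ξ ((ξ ^ k) (γ t)) = _
      rw [ih, hsym]; congr 2; push_cast; ring
  have h6 : Function.Periodic γ (6 * τ) := fun t => by
    have h1 := hpow 6 t
    rw [← hξ, pow_orderOf_eq_one, hξ] at h1
    exact (Subtype.ext h1).symm
  have hle : ℓ ≤ 6 * τ := hℓ.2 ⟨by positivity, h6⟩
  have hm6 : m = 6 := by
    have h1 : (m : ℝ) ≤ 6 := by
      have : ℓ = m * τ := by rw [hτ]; field_simp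
      rw [this] at hle
      exact le_of_mul_le_mul_right hle hτ0
    exact le_antisymm (by exact_mod_cast h1) (Nat.le_of_dvd hm (hsix m hFij))
  have : ℓ / 6 = τ := by rw [hτ, hm6]; norm_num
  rw [this]
  exact hsym

end NeckerCube
end

theorem theorem1p2 (γ : ℝ → NeckerCube.surface) (hγ : NeckerCube.IsGeodesic γ)
    (ℓ : ℝ) (hℓ : NeckerCube.IsLeastPeriod γ ℓ) :
    ∃ ξ : NeckerCube.E3 ≃ᵢ NeckerCube.E3,
      orderOf ξ = 6 ∧ ξ '' NeckerCube.surface = NeckerCube.surface ∧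
        ∀ t : ℝ, ξ (γ t) = γ (t + ℓ / 6) := by
  obtain ⟨t₀, F, hF, x, y, v₁, v₂, hx, hx', hy, hy', hv₁, hv₂, hv, h⟩ := hγ.exists_interior
  have hper : ∀ p, Function.Periodic (fun t => γ (t₀ + t)) p ↔ Function.Periodic γ p := by
    refine fun p => ⟨fun h t => ?_, fun h t => ?_⟩
    · have := h (t - t₀)
      simp only [add_sub_cancel] at this
      rw [← this]; congr 1; ring
    · simp only [← add_assoc]; exact h _
  have hℓ' : NeckerCube.IsLeastPeriod (fun t => γ (t₀ + t)) ℓ := by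
    simpa only [NeckerCube.IsLeastPeriod, hper] using hℓ
  obtain ⟨ξ, h1, h2, h3⟩ := (hγ.comp_add t₀).exists_symmetry hℓ' hF hx hx' hy hy' hv₁ hv₂ hv <| by
    have hc : Filter.Tendsto (fun s => t₀ + s) (nhds 0) (nhds t₀) := by
      have : ContinuousAt (fun s => t₀ + s) 0 := by fun_prop
      simpa using this.tendsto
    filter_upwards [hc.eventually h] with s hs
    simpa using hs
  refine ⟨ξ, h1, h2, fun t => ?_⟩
  have := h3 (t - t₀)
  rw [add_sub_cancel] at this
  rw [this]; congr 2; ring
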